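/- **Setting.** Let $\ell^2=\ell^2(\mathbb R)$ be the space of real square-summable sequences $(c_i)_{i\ge1}$. Let $(\psi_i)_{i\ge 1}$ be the Haar system: $\psi_1=\phi=1_{[0,1)}$ and, for $i=2^j+k+1$ with $j\ge0$, $0\le k<2^j$, $\psi_i=\psi_{j,k}$ equals $2^{j/2}$ on $[\frac{k}{2^j},\frac{k+1/2}{2^j})$, $-2^{j/2}$ on $[\frac{k+1/2}{2^j},\frac{k+1}{2^j})$, and $0$ elsewhere. Let $w_i$ be its integrals on $[0,1]$: $w_1(t)=t$ and, for $i=2^j+k+1$, $w_i(t)=2^{j/2}(t-\frac{k}{2^j})$ on $[\frac{k}{2^j},\frac{k+1/2}{2^j}]$, $w_i(t)=2^{j/2}(\frac{k+1}{2^j}-t)$ on $[\frac{k+1/2}{2^j},\frac{k+1}{2^j}]$, and $0$ elsewhere; let $\mathbf w(t)=(w_1(t),w_2(t),\dots)^T$. Let $(\mathcal Hf)_i=\int_0^1 f\psi_i\,dt$ be the Haar transform, $P$ the infinite matrix $P_{i,l}=\int_0^1\psi_l w_i\,dt$, and for $m=2^j$ let $H_m$ be the $m\times m$ Haar matrix $(H_m)_{p,q}=\psi_p\big(\frac{q-1/2}{m}\big)$.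 Let $\odot$ be the entrywise product of sequences. For an infinite matrix $A$ and sequences $x,y$, $x^TAy$ is the double series $\sum_{i,l}x_iA_{i,l}y_l$ and $(Ax)_i=\sum_l A_{i,l}x_l$. An infinite matrix "given recursively" is the one whose upper left $m\times m$ corners, $m=2^j$, are the given matrices. **Theorem 4.1.** For $\mathbf c,\mathbf d\in\ell^2$ and $t\in[0,1]$ the double series $W(\mathbf c,\mathbf d)(t):=\mathbf c^T\mathbf w(t)\mathbf w^T(t)\mathbf d$ converges absolutely, $W(\mathbf c,\mathbf d)\in L^2([0,1])$, and there is a constant $C>0$ such that $$\|W(\mathbf c,\mathbf d)\|_{L^2}\le C\,\|\mathbf c\|_{\ell^2}\|\mathbf d\|_{\ell^2}\qquad\text{for all }\mathbf c,\mathbf d\in\ell^2 .$$ Moreover, let $\mathbf c,\mathbf d\in\ell^2$, $\mathbf a:=P^T\mathbf c$ and $\mathbf b:=P^T\mathbf d$. These are well-defined elements of $\ell^2$. Define $\Omega(t)$ recursively, for $m=2^j$, $j=0,1,2,\dots$, by $$\Omega_1(t)=0,\qquad \Omega_{2m}(t)=\begin{bmatrix}\Omega_m(t)&\Upsilon_m(t)\\0&0\end{bmatrix},\qquad(\Upsilon_m)_{i,l}(t)=(H_m)_{i,l}\,\psi_{m+l}(t),$$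 let $\Theta(t)=\operatorname{diag}(\psi_1^2(t),\psi_2^2(t),\dots)$, and define $\tilde\Omega$ and $\Gamma$ recursively by $$\tilde\Omega_1=0,\quad\tilde\Omega_{2m}=\begin{bmatrix}\tilde\Omega_m&H_m\\0&0\end{bmatrix},\qquad \Gamma_1=1,\quad\Gamma_{2m}=\begin{bmatrix}\Gamma_m&0\\H_m^T&0\end{bmatrix}.$$ 1. For every $t\in[0,1]$ the double series $\mathbf a^T\Omega(t)\mathbf b$, $\mathbf a^T\Omega^T(t)\mathbf b$ and $\mathbf a^T\Theta(t)\mathbf b$ converge absolutely, and for every $t\in[0,1)$ (so almost everywhere on $[0,1]$) $$\mathbf c^T\mathbf w(t)\mathbf w^T(t)\mathbf d=\mathbf a^T\Omega(t)\mathbf b+\mathbf a^T\Omega^T(t)\mathbf b+\mathbf a^T\Theta(t)\mathbf b .$$ 2. The three terms on the right, as functions of $t$, are in $L^2([0,1])$, and $$\mathcal H(\mathbf c^T\mathbf w\mathbf w^T\mathbf d)=\mathcal H(\mathbf a^T\Omega\mathbf b)+\mathcal H(\mathbf a^T\Omega^T\mathbf b)+\mathcal H(\mathbf a^T\Theta\mathbf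 b).$$ 3. The series defining $\tilde\Omega^T\mathbf a$, $\tilde\Omega^T\mathbf b$ and $\Gamma^T(\mathbf a\odot\mathbf b)$ converge absolutely, and $$\mathcal H(\mathbf a^T\Omega\mathbf b)=(\tilde\Omega^T\mathbf a)\odot\mathbf b,\qquad \mathcal H(\mathbf a^T\Omega^T\mathbf b)=(\tilde\Omega^T\mathbf b)\odot\mathbf a,\qquad \mathcal H(\mathbf a^T\Theta\mathbf b)=\Gamma^T(\mathbf a\odot\mathbf b),$$ all three sequences being in $\ell^2$. -/

import Mathlib

open MeasureTheory Set
open scoped ENNReal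

noncomputable section

namespace HaarBiform

/-! Sequences and infinite matrices are indexed by `ℕ` starting from `0`: the index `i` below is the
`(i + 1)`-st index of the usual one-based enumeration.  So `0` is the index of the scaling function,
and `2 ^ j + k` with `k < 2 ^ j` is the index of the wavelet of level `j` and shift `k`. -/

/-- The Hilbert space of real square-summable sequences. -/
abbrev SeqL2 : Type := lp (fun _ : ℕ => ℝ) 2

/-- The scaling function, the indicator of `[0, 1)`. -/
def scaling (t : ℝ) : ℝ := if 0 ≤ t ∧ t < 1 then 1 else 0

/-- The Haar wavelet of level `j` and shift `k`. -/
def wavelet (j k : ℕ) (t : ℝ) : ℝ :=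
  if (k : ℝ) / 2 ^ j ≤ t ∧ t < ((k : ℝ) + 1 / 2) / 2 ^ j then √(2 ^ j)
  else if ((k : ℝ) + 1 / 2) / 2 ^ j ≤ t ∧ t < ((k : ℝ) + 1) / 2 ^ j then -√(2 ^ j)
  else 0

/-- The integral of the Haar wavelet of level `j` and shift `k` (a triangular function). -/
def waveletInt (j k : ℕ) (t : ℝ) : ℝ :=
  if (k : ℝ) / 2 ^ j ≤ t ∧ t ≤ ((k : ℝ) + 1 / 2) / 2 ^ j then
    √(2 ^ j) * (t - (k : ℝ) / 2 ^ j)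
  else if ((k : ℝ) + 1 / 2) / 2 ^ j ≤ t ∧ t ≤ ((k : ℝ) + 1) / 2 ^ j then
    √(2 ^ j) * (((k : ℝ) + 1) / 2 ^ j - t)
  else 0

/-- The Haar system in one-index notation. -/
def psi (i : ℕ) (t : ℝ) : ℝ :=
  if i = 0 then scaling t else wavelet (Nat.log 2 i) (i - 2 ^ Nat.log 2 i) t

/-- The integrals (on `[0, 1]`) of the Haar system in one-index notation. -/
def w (i : ℕ) (t : ℝ) : ℝ :=
  if i = 0 then t else waveletInt (Nat.log 2 i) (i - 2 ^ Nat.log 2 i) t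

/-- The Haar transform: the sequence of Haar coefficients of `f`. -/
def haarTransform (f : ℝ → ℝ) (i : ℕ) : ℝ := ∫ t in (0 : ℝ)..1, f t * psi i t

/-- Lebesgue measure on `[0, 1]`. -/
abbrev unitMeasure : Measure ℝ := volume.restrict (Icc (0 : ℝ) 1)

/-- The series which define the product of the infinite matrix `A` with the sequence `x`
all converge (absolutely). -/
def MulVecSummable (A : Matrix ℕ ℕ ℝ) (x : ℕ → ℝ) : Prop :=
  ∀ i, Summable fun l => A i l * x l

/-- The product of an infinite matrix with a sequence. -/
def mulVec (A : Matrix ℕ ℕ ℝ) (x : ℕ → ℝ) (i : ℕ) : ℝ := ∑' l, A i l * x l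

/-- The double series which defines `xᵀ A y` converges (absolutely). -/
def FormSummable (x : ℕ → ℝ) (A : Matrix ℕ ℕ ℝ) (y : ℕ → ℝ) : Prop :=
  Summable fun p : ℕ × ℕ => x p.1 * A p.1 p.2 * y p.2

/-- The bilinear form `xᵀ A y` of an infinite matrix `A`. -/
def form (x : ℕ → ℝ) (A : Matrix ℕ ℕ ℝ) (y : ℕ → ℝ) : ℝ :=
  ∑' p : ℕ × ℕ, x p.1 * A p.1 p.2 * y p.2

/-- The infinite matrix `w(t) w(t)ᵀ`. -/
def wwT (t : ℝ) : Matrix ℕ ℕ ℝ := Matrix.vecMulVec (fun i => w i t) (fun i => w i t)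

/-- The function `W(c, d)(t) = cᵀ w(t) w(t)ᵀ d`. -/
def W (c d : ℕ → ℝ) (t : ℝ) : ℝ := form c (wwT t) d

/-- The infinite matrix `P` of integration in the Haar system. -/
def P : Matrix ℕ ℕ ℝ := fun i l => ∫ t in (0 : ℝ)..1, psi l t * w i t

/-- The Haar matrix of order `2 ^ j`: the first `2 ^ j` Haar functions sampled at the midpoints of
the dyadic intervals of length `2 ^ (-j)`. -/
def haarMatrix (j : ℕ) : Matrix (Fin (2 ^ j)) (Fin (2 ^ j)) ℝ :=
  fun p q => psi p (((q : ℝ) + 1 / 2) / 2 ^ j)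

/-- The square matrix of order `2 ^ (j + 1)` with the four given blocks of order `2 ^ j`. -/
def blocks {j : ℕ} (A B C D : Matrix (Fin (2 ^ j)) (Fin (2 ^ j)) ℝ) :
    Matrix (Fin (2 ^ (j + 1))) (Fin (2 ^ (j + 1))) ℝ :=
  let e : Fin (2 ^ j) ⊕ Fin (2 ^ j) ≃ Fin (2 ^ (j + 1)) :=
    finSumFinEquiv.trans (finCongr (by rw [pow_succ, mul_two]))
  Matrix.reindex e e (Matrix.fromBlocks A B C D)

/-- The infinite matrix whose upper left corners are the matrices `A j` of order `2 ^ j`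
(when each of these is the upper left block of the next, see `limitMatrix_apply`). -/
def limitMatrix (A : ∀ j : ℕ, Matrix (Fin (2 ^ j)) (Fin (2 ^ j)) ℝ) : Matrix ℕ ℕ ℝ :=
  fun i l => A (i + l)
    ⟨i, (Nat.le_add_right i l).trans_lt Nat.lt_two_pow_self⟩
    ⟨l, (Nat.le_add_left l i).trans_lt Nat.lt_two_pow_self⟩

lemma blocks_apply_of_lt {j : ℕ} (A B C D : Matrix (Fin (2 ^ j)) (Fin (2 ^ j)) ℝ) {i l : ℕ}
    (hi : i < 2 ^ j) (hl : l < 2 ^ j) (hi' : i < 2 ^ (j + 1)) (hl' : l < 2 ^ (j + 1)) :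
    blocks A B C D ⟨i, hi'⟩ ⟨l, hl'⟩ = A ⟨i, hi⟩ ⟨l, hl⟩ := by
  have h : 2 ^ j + 2 ^ j = 2 ^ (j + 1) := by rw [pow_succ, mul_two]
  have key : ∀ (n : ℕ) (hn : n < 2 ^ j) (hn' : n < 2 ^ (j + 1)),
      ((finSumFinEquiv (m := 2 ^ j) (n := 2 ^ j)).trans (finCongr h)).symm ⟨n, hn'⟩
        = Sum.inl ⟨n, hn⟩ := by
    intro n hn hn'
    rw [Equiv.symm_apply_eq]
    ext
    simp
  simp only [blocks, Matrix.reindex_apply, Matrix.submatrix_apply]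
  rw [key i hi hi', key l hl hl', Matrix.fromBlocks_apply₁₁]

lemma limitMatrix_apply (A B C D : ∀ j : ℕ, Matrix (Fin (2 ^ j)) (Fin (2 ^ j)) ℝ)
    (hA : ∀ j, A (j + 1) = blocks (A j) (B j) (C j) (D j)) (j : ℕ) (i l : Fin (2 ^ j)) :
    limitMatrix A i l = A j i l := by
  have mono : ∀ (n k : ℕ) (i l : ℕ) (hi : i < 2 ^ n) (hl : l < 2 ^ n)
      (hi' : i < 2 ^ (n + k)) (hl' : l < 2 ^ (n + k)),
      A (n + k) ⟨i, hi'⟩ ⟨l, hl'⟩ = A n ⟨i, hi⟩ ⟨l, hl⟩ := by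
    intro n k
    induction k with
    | zero => intros; rfl
    | succ k ih =>
      intro i l hi hl hi' hl'
      have hle : 2 ^ n ≤ 2 ^ (n + k) := Nat.pow_le_pow_right (by norm_num) (Nat.le_add_right n k)
      have := hA (n + k)
      rw [show A (n + (k + 1)) = blocks (A (n + k)) (B (n + k)) (C (n + k)) (D (n + k)) from this,
        blocks_apply_of_lt _ _ _ _ (hi.trans_le hle) (hl.trans_le hle)]
      exact ih i l hi hl _ _
  have h1 : (i : ℕ) < 2 ^ ((i : ℕ) + l) := (Nat.le_add_right _ _).trans_lt Nat.lt_two_pow_self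
  have h2 : (l : ℕ) < 2 ^ ((i : ℕ) + l) := (Nat.le_add_left _ _).trans_lt Nat.lt_two_pow_self
  have hle : 2 ^ ((i : ℕ) + l) ≤ 2 ^ ((i : ℕ) + l + j) :=
    Nat.pow_le_pow_right (by norm_num) (Nat.le_add_right _ _)
  have e1 := mono ((i : ℕ) + l) j i l h1 h2 (h1.trans_le hle) (h2.trans_le hle)
  have hle' : 2 ^ j ≤ 2 ^ (j + ((i : ℕ) + l)) :=
    Nat.pow_le_pow_right (by norm_num) (Nat.le_add_right _ _)
  have e2 := mono j ((i : ℕ) + l) i l i.2 l.2 (i.2.trans_le hle') (l.2.trans_le hle')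
  have e3 : ∀ (n m : ℕ) (_ : n = m) (hi : (i : ℕ) < 2 ^ n) (hl : (l : ℕ) < 2 ^ n)
      (hi' : (i : ℕ) < 2 ^ m) (hl' : (l : ℕ) < 2 ^ m),
      A n ⟨i, hi⟩ ⟨l, hl⟩ = A m ⟨i, hi'⟩ ⟨l, hl'⟩ := by
    intro n m hnm
    subst hnm
    intros
    rfl
  exact e1.symm.trans ((e3 _ _ (Nat.add_comm _ _) _ _ _ _).trans e2)

/-- The block `Υ` of order `2 ^ j`. -/
def upsilon (t : ℝ) (j : ℕ) : Matrix (Fin (2 ^ j)) (Fin (2 ^ j)) ℝ :=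
  fun i l => haarMatrix j i l * psi (2 ^ j + l) t

/-- The matrix `Ω(t)` of order `2 ^ j`. -/
def omegaBlock (t : ℝ) : ∀ j : ℕ, Matrix (Fin (2 ^ j)) (Fin (2 ^ j)) ℝ
  | 0 => 0
  | j + 1 => blocks (omegaBlock t j) (upsilon t j) 0 0

/-- The infinite matrix `Ω(t)`. -/
def omega (t : ℝ) : Matrix ℕ ℕ ℝ := limitMatrix (omegaBlock t)

/-- The infinite diagonal matrix `Θ(t)`. -/
def theta (t : ℝ) : Matrix ℕ ℕ ℝ := Matrix.diagonal fun i => psi i t ^ 2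

/-- The matrix `Ω̃` of order `2 ^ j`. -/
def omegaTildeBlock : ∀ j : ℕ, Matrix (Fin (2 ^ j)) (Fin (2 ^ j)) ℝ
  | 0 => 0
  | j + 1 => blocks (omegaTildeBlock j) (haarMatrix j) 0 0

/-- The infinite matrix `Ω̃`. -/
def omegaTilde : Matrix ℕ ℕ ℝ := limitMatrix omegaTildeBlock

/-- The matrix `Γ` of order `2 ^ j`. -/
def gammaBlock : ∀ j : ℕ, Matrix (Fin (2 ^ j)) (Fin (2 ^ j)) ℝ
  | 0 => 1
  | j + 1 => blocks (gammaBlock j) 0 (haarMatrix j).transpose 0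

/-- The infinite matrix `Γ`. -/
def gamma : Matrix ℕ ℕ ℝ := limitMatrix gammaBlock

end HaarBiform

end

open HaarBiform

namespace HaarBiform

open Filter Topology

/-! By the definition of its integral, `w i t` is the Haar coefficient of the indicator of `[0, t)`.
Bessel's inequality and Cauchy–Schwarz therefore bound the series of `c i * w i t` absolutely by
`‖c‖` (`sum_abs_mul_w_le`). Its sum `primitive c` is Hölder continuous of order 1/2
(`abs_primitive_sub_le`), and `W c d` is the product of two such functions, bounded by `‖c‖ * ‖d‖`.

Termwise integration shows that `Pᵀ c` is the sequence of Haar coefficients of `primitive c`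
(`mulVec_P`). Hölder continuity makes the level `j` term of its Haar series at most `‖c‖ * 2 ^ (-j /
2)`, and only one wavelet per level is nonzero at a given point. So the series converges absolutely
with a bound uniform in `t` (`exists_sum_abs_mul_psi_le`). Its dyadic partial sums are averages,
hence its sum is `primitive c` on `[0, 1)` (`tsum_haarTransform_mul_psi`).

Multiplying two such series gives a double series in `psi i t * psi l t`. If `i` is of coarser level
than `l`, then `psi i` is constant on the support of `psi l`. If the levels agree and `i ≠ l`, the
product vanishes. The three possibilities are the entries of `Ω`, `Ωᵀ` and `Θ`
(`psi_mul_psi_eq_add`). The uniform bounds allow integration against `psi n` term by term, and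
orthonormality with `integral_psi_sq_mul_psi` yields `Ω̃` and `Γ`. Square summability is Bessel's
inequality again. -/

/-- The midpoint of the support of the Haar wavelet with index `i`. -/
noncomputable def midpt (i : ℕ) : ℝ := (((i - 2 ^ Nat.log 2 i : ℕ) : ℝ) + 1 / 2) / 2 ^ Nat.log 2 i

/-! ### Dyadic structure of the Haar system -/

lemma log_two_pow_add {j k : ℕ} (hk : k < 2 ^ j) : Nat.log 2 (2 ^ j + k) = j :=
  Nat.log_eq_of_pow_le_of_lt_pow (by omega) (by rw [pow_succ]; omega)

lemma exists_eq_two_pow_add {i : ℕ} (hi : i ≠ 0) : ∃ j k, k < 2 ^ j ∧ i = 2 ^ j + k := by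
  have h1 := Nat.pow_log_le_self 2 hi
  have h2 := Nat.lt_pow_succ_log_self (b := 2) one_lt_two i
  rw [pow_succ] at h2
  exact ⟨Nat.log 2 i, i - 2 ^ Nat.log 2 i, by omega, by omega⟩

lemma psi_zero (t : ℝ) : psi 0 t = scaling t := by simp [psi]

lemma psi_two_pow_add {j k : ℕ} (hk : k < 2 ^ j) (t : ℝ) :
    psi (2 ^ j + k) t = wavelet j k t := by
  have : 2 ^ j + k ≠ 0 := by positivity
  simp [psi, log_two_pow_add hk]

lemma w_two_pow_add {j k : ℕ} (hk : k < 2 ^ j) (t : ℝ) :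
    w (2 ^ j + k) t = waveletInt j k t := by
  have : 2 ^ j + k ≠ 0 := by positivity
  simp [w, log_two_pow_add hk]

lemma midpt_two_pow_add {j k : ℕ} (hk : k < 2 ^ j) :
    midpt (2 ^ j + k) = ((k : ℝ) + 1 / 2) / 2 ^ j := by
  simp [midpt, log_two_pow_add hk]

lemma scaling_eq (t : ℝ) : scaling t = (Ico (0 : ℝ) 1).indicator 1 t := by
  simp [scaling, indicator_apply]

lemma dyadic_lt_mid (j k : ℕ) : (k : ℝ) / 2 ^ j < ((k : ℝ) + 1 / 2) / 2 ^ j := by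
  gcongr; norm_num

lemma mid_lt_dyadic (j k : ℕ) : ((k : ℝ) + 1 / 2) / 2 ^ j < ((k : ℝ) + 1) / 2 ^ j := by
  gcongr; norm_num

lemma dyadic_le_one {j k : ℕ} (hk : k < 2 ^ j) : ((k : ℝ) + 1) / 2 ^ j ≤ 1 := by
  rw [div_le_one (by positivity)]
  exact_mod_cast hk

lemma wavelet_eq (j k : ℕ) (t : ℝ) :
    wavelet j k t = √(2 ^ j) *
      ((Ico ((k : ℝ) / 2 ^ j) (((k : ℝ) + 1 / 2) / 2 ^ j)).indicator 1 t -
        (Ico (((k : ℝ) + 1 / 2) / 2 ^ j) (((k : ℝ) + 1) / 2 ^ j)).indicator 1 t) := by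
  simp only [wavelet, indicator_apply, mem_Ico, Pi.one_apply]
  split_ifs <;> simp
  linarith

lemma wavelet_sq (j k : ℕ) (t : ℝ) :
    wavelet j k t ^ 2 =
      2 ^ j * (Ico ((k : ℝ) / 2 ^ j) (((k : ℝ) + 1) / 2 ^ j)).indicator 1 t := by
  have h1 := dyadic_lt_mid j k
  have h2 := mid_lt_dyadic j k
  have h3 : √(2 ^ j : ℝ) ^ 2 = 2 ^ j := Real.sq_sqrt (by positivity)
  simp only [wavelet, indicator_apply, mem_Ico, Pi.one_apply]
  split_ifs <;> simp only [neg_sq, h3, mul_one, mul_zero, ne_eq, OfNat.ofNat_ne_zero,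
    not_false_eq_true, zero_pow]
  all_goals grind

lemma wavelet_eq_zero {j k : ℕ} {t : ℝ}
    (h : ¬((k : ℝ) / 2 ^ j ≤ t ∧ t < ((k : ℝ) + 1) / 2 ^ j)) : wavelet j k t = 0 := by
  have := wavelet_sq j k t
  rw [indicator_of_notMem (by simpa using h), mul_zero] at this
  exact pow_eq_zero_iff two_ne_zero |>.1 this

lemma measurable_psi (i : ℕ) : Measurable (psi i) := by
  rcases eq_or_ne i 0 with rfl | hi
  · rw [show psi 0 = (Ico (0 : ℝ) 1).indicator 1 from
      funext fun t => (psi_zero t).trans (scaling_eq t)]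
    exact measurable_one.indicator measurableSet_Ico
  · obtain ⟨j, k, hk, rfl⟩ := exists_eq_two_pow_add hi
    rw [show psi (2 ^ j + k) = _ from
      funext fun t => (psi_two_pow_add hk t).trans (wavelet_eq j k t)]
    exact ((measurable_one.indicator measurableSet_Ico).sub
      (measurable_one.indicator measurableSet_Ico)).const_mul _

lemma abs_wavelet_le (j k : ℕ) (t : ℝ) : |wavelet j k t| ≤ √(2 ^ j) := by
  unfold wavelet
  split_ifs <;> simp [abs_of_nonneg]

lemma exists_abs_psi_le (i : ℕ) : ∃ M : ℝ, 0 ≤ M ∧ ∀ t, |psi i t| ≤ M := by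
  rcases eq_or_ne i 0 with rfl | hi
  · refine ⟨1, zero_le_one, fun t => ?_⟩
    rw [psi_zero, scaling]
    split_ifs <;> simp
  · obtain ⟨j, k, hk, rfl⟩ := exists_eq_two_pow_add hi
    exact ⟨_, Real.sqrt_nonneg _, fun t => psi_two_pow_add hk t ▸ abs_wavelet_le j k t⟩

lemma psi_eq_zero {i : ℕ} {t : ℝ} (ht : ¬(0 ≤ t ∧ t < 1)) : psi i t = 0 := by
  rcases eq_or_ne i 0 with rfl | hi
  · rw [psi_zero, scaling, if_neg ht]
  · obtain ⟨j, k, hk, rfl⟩ := exists_eq_two_pow_add hi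
    rw [psi_two_pow_add hk]
    refine wavelet_eq_zero fun h => ht ⟨le_trans (by positivity) h.1, h.2.trans_le ?_⟩
    exact dyadic_le_one hk

/-- A breakpoint of level `n ≤ j` is a multiple of `2 ^ (-j)`, so comparing it with `t` depends only
on the level `j` interval containing `t`. This is why coarse Haar functions are constant on fine
intervals. -/
lemma dyadic_le_iff {n j m k : ℕ} {t : ℝ} (h : n ≤ j) (h1 : (k : ℝ) / 2 ^ j ≤ t)
    (h2 : t < ((k : ℝ) + 1) / 2 ^ j) : (m : ℝ) / 2 ^ n ≤ t ↔ m * 2 ^ (j - n) ≤ k := by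
  have e : (m : ℝ) / 2 ^ n = ((m * 2 ^ (j - n) : ℕ) : ℝ) / 2 ^ j := by
    push_cast
    rw [div_eq_div_iff (by positivity) (by positivity), mul_assoc, ← pow_add,
      Nat.sub_add_cancel h]
  rw [e]
  constructor
  · intro h3
    have := (div_lt_div_iff_of_pos_right (by positivity)).1 (h3.trans_lt h2)
    exact Nat.lt_succ_iff.1 (by exact_mod_cast this)
  · intro h3
    refine le_trans ?_ h1
    gcongr

/-- All breakpoints of a level `j` wavelet, its midpoint included, are multiples of `2 ^ (-(j +
1))`, and `j + 1 ≤ n`. -/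
lemma wavelet_congr {j k n m : ℕ} {s t : ℝ} (h : j < n)
    (hs : (m : ℝ) / 2 ^ n ≤ s ∧ s < ((m : ℝ) + 1) / 2 ^ n)
    (ht : (m : ℝ) / 2 ^ n ≤ t ∧ t < ((m : ℝ) + 1) / 2 ^ n) : wavelet j k s = wavelet j k t := by
  have e1 : ((k : ℝ) + 1 / 2) / 2 ^ j = ((2 * k + 1 : ℕ) : ℝ) / 2 ^ (j + 1) := by
    push_cast; field_simp; ring
  have e2 : ((k : ℝ) + 1) / 2 ^ j = ((k + 1 : ℕ) : ℝ) / 2 ^ j := by push_cast; rfl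
  simp only [wavelet, e1, e2, ← not_le, dyadic_le_iff h hs.1 hs.2, dyadic_le_iff h ht.1 ht.2,
    dyadic_le_iff h.le hs.1 hs.2, dyadic_le_iff h.le ht.1 ht.2]

lemma psi_congr {i n m : ℕ} {s t : ℝ} (h : i < 2 ^ n)
    (hs : (m : ℝ) / 2 ^ n ≤ s ∧ s < ((m : ℝ) + 1) / 2 ^ n)
    (ht : (m : ℝ) / 2 ^ n ≤ t ∧ t < ((m : ℝ) + 1) / 2 ^ n) : psi i s = psi i t := by
  rcases eq_or_ne i 0 with rfl | hi
  · have h0 : ∀ x : ℝ, 0 ≤ x ↔ ((0 : ℕ) : ℝ) / 2 ^ 0 ≤ x := by simp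
    have h1 : ∀ x : ℝ, x < 1 ↔ ¬ ((1 : ℕ) : ℝ) / 2 ^ 0 ≤ x := by simp
    simp only [psi_zero, scaling, h0, h1, dyadic_le_iff (Nat.zero_le n) hs.1 hs.2,
      dyadic_le_iff (Nat.zero_le n) ht.1 ht.2]
  · obtain ⟨j, k, hk, rfl⟩ := exists_eq_two_pow_add hi
    rw [psi_two_pow_add hk, psi_two_pow_add hk]
    exact wavelet_congr ((Nat.pow_lt_pow_iff_right one_lt_two).1 (by omega)) hs ht

/-- A Haar function of coarser level is constant on the support of a finer one. -/
lemma psi_mul_psi {i l : ℕ} (hl : l ≠ 0) (h : i < 2 ^ Nat.log 2 l) (t : ℝ) :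
    psi i t * psi l t = psi i (midpt l) * psi l t := by
  obtain ⟨j, k, hk, rfl⟩ := exists_eq_two_pow_add hl
  rw [log_two_pow_add hk] at h
  rw [midpt_two_pow_add hk, psi_two_pow_add hk]
  by_cases ht : (k : ℝ) / 2 ^ j ≤ t ∧ t < ((k : ℝ) + 1) / 2 ^ j
  · rw [psi_congr h ht ⟨(dyadic_lt_mid j k).le, mid_lt_dyadic j k⟩]
  · simp [wavelet_eq_zero ht]

lemma floor_eq_of_mem {j k : ℕ} {t : ℝ} (h : (k : ℝ) / 2 ^ j ≤ t ∧ t < ((k : ℝ) + 1) / 2 ^ j) :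
    ⌊t * 2 ^ j⌋₊ = k := by
  rw [div_le_iff₀ (by positivity), lt_div_iff₀ (by positivity)] at h
  exact (Nat.floor_eq_iff (le_trans (by positivity) h.1)).2 h

/-- Distinct Haar functions of the same level have disjoint supports. -/
lemma psi_mul_psi_eq_zero {i l : ℕ} (hil : i ≠ l) (h1 : ¬(l ≠ 0 ∧ i < 2 ^ Nat.log 2 l))
    (h2 : ¬(i ≠ 0 ∧ l < 2 ^ Nat.log 2 i)) (t : ℝ) : psi i t * psi l t = 0 := by
  have hl : l ≠ 0 := fun h => h2 ⟨by omega, by rw [h]; positivity⟩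
  have hi : i ≠ 0 := fun h => h1 ⟨hl, by rw [h]; positivity⟩
  obtain ⟨j, k, hk, rfl⟩ := exists_eq_two_pow_add hl
  obtain ⟨j', k', hk', rfl⟩ := exists_eq_two_pow_add hi
  rw [log_two_pow_add hk] at h1
  rw [log_two_pow_add hk'] at h2
  have hj : ¬ j' < j := fun h => h1 ⟨hl, by
    have := Nat.pow_le_pow_right two_pos (Nat.succ_le_of_lt h)
    rw [Nat.pow_succ] at this; omega⟩
  have hj' : ¬ j < j' := fun h => h2 ⟨hi, by
    have := Nat.pow_le_pow_right two_pos (Nat.succ_le_of_lt h)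
    rw [Nat.pow_succ] at this; omega⟩
  obtain rfl : j = j' := by omega
  rw [psi_two_pow_add hk, psi_two_pow_add hk']
  by_contra h
  rw [← ne_eq, mul_ne_zero_iff] at h
  have e1 := floor_eq_of_mem (not_not.1 (mt wavelet_eq_zero h.1))
  have e2 := floor_eq_of_mem (not_not.1 (mt wavelet_eq_zero h.2))
  exact hil (by rw [← e1, ← e2])

/-! ### Integrals of products of Haar functions -/

lemma integral_mul_indicator (g : ℝ → ℝ) {a b : ℝ} (ha : 0 ≤ a) (hab : a ≤ b) (hb : b ≤ 1) :
    ∫ t in (0 : ℝ)..1, g t * (Ico a b).indicator 1 t = ∫ t in a..b, g t := by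
  have e : (fun t => g t * (Ico a b).indicator 1 t) = (Ico a b).indicator g := by
    ext t; by_cases h : t ∈ Ico a b <;> simp [h]
  rw [e, intervalIntegral.integral_of_le zero_le_one, ← integral_Icc_eq_integral_Ioc,
    setIntegral_indicator measurableSet_Ico, intervalIntegral.integral_of_le hab,
    ← integral_Ico_eq_integral_Ioc]
  congr 2
  ext x
  simp only [mem_inter_iff, mem_Icc, mem_Ico]
  grind

lemma integral_eq_unitMeasure (f : ℝ → ℝ) :
    ∫ t in (0 : ℝ)..1, f t = ∫ t, f t ∂unitMeasure := by
  rw [intervalIntegral.integral_of_le zero_le_one, ← integral_Icc_eq_integral_Ioc]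

lemma intervalIntegrable_iff_unitMeasure {f : ℝ → ℝ} :
    IntervalIntegrable f volume 0 1 ↔ Integrable f unitMeasure :=
  intervalIntegrable_iff_integrableOn_Icc_of_le zero_le_one

instance : IsProbabilityMeasure unitMeasure := ⟨by simp⟩

lemma haarTransform_two_pow_add {g : ℝ → ℝ} (hg : Integrable g unitMeasure) {j k : ℕ}
    (hk : k < 2 ^ j) : haarTransform g (2 ^ j + k) = √(2 ^ j) *
      ((∫ t in (k : ℝ) / 2 ^ j..((k : ℝ) + 1 / 2) / 2 ^ j, g t) -
        ∫ t in ((k : ℝ) + 1 / 2) / 2 ^ j..((k : ℝ) + 1) / 2 ^ j, g t) := by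
  have h1 := dyadic_lt_mid j k
  have h2 := mid_lt_dyadic j k
  have h3 := dyadic_le_one hk
  have h0 : 0 ≤ (k : ℝ) / 2 ^ j := by positivity
  have hint : ∀ a b : ℝ, IntervalIntegrable (fun t => g t * (Ico a b).indicator 1 t) volume 0 1 := by
    intro a b
    rw [intervalIntegrable_iff_unitMeasure]
    refine (hg.indicator (measurableSet_Ico (a := a) (b := b))).congr (ae_of_all _ fun t => ?_)
    by_cases h : t ∈ Ico a b <;> simp [h]
  rw [← integral_mul_indicator g h0 h1.le (h2.le.trans h3),
    ← integral_mul_indicator g (h0.trans h1.le) h2.le h3,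
    ← intervalIntegral.integral_sub (hint _ _) (hint _ _), ← intervalIntegral.integral_const_mul,
    haarTransform]
  refine intervalIntegral.integral_congr fun t _ => ?_
  simp only [psi_two_pow_add hk, wavelet_eq]
  ring

lemma haarTransform_zero (g : ℝ → ℝ) : haarTransform g 0 = ∫ t in (0 : ℝ)..1, g t := by
  rw [← integral_mul_indicator g le_rfl zero_le_one le_rfl, haarTransform]
  simp only [psi_zero, scaling_eq]

lemma integral_psi {i : ℕ} (hi : i ≠ 0) : ∫ t in (0 : ℝ)..1, psi i t = 0 := by
  obtain ⟨j, k, hk, rfl⟩ := exists_eq_two_pow_add hi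
  have := haarTransform_two_pow_add (integrable_const (1 : ℝ)) hk
  simp only [haarTransform, one_mul, intervalIntegral.integral_const, smul_eq_mul, mul_one] at this
  rw [this]
  ring

lemma integral_psi_sq (i : ℕ) : ∫ t in (0 : ℝ)..1, psi i t ^ 2 = 1 := by
  rcases eq_or_ne i 0 with rfl | hi
  · have : ∀ t, psi 0 t ^ 2 = 1 * (Ico (0 : ℝ) 1).indicator 1 t := by
      intro t
      rw [psi_zero, scaling_eq]
      by_cases h : t ∈ Ico (0 : ℝ) 1 <;> simp [h]
    simp only [this]
    rw [integral_mul_indicator _ le_rfl zero_le_one le_rfl]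
    simp
  · obtain ⟨j, k, hk, rfl⟩ := exists_eq_two_pow_add hi
    simp only [psi_two_pow_add hk, wavelet_sq]
    rw [integral_mul_indicator _ (by positivity) ((dyadic_lt_mid j k).trans (mid_lt_dyadic j k)).le
      (dyadic_le_one hk)]
    simp only [intervalIntegral.integral_const, smul_eq_mul]
    field_simp
    ring

lemma integral_psi_mul_psi (i l : ℕ) :
    ∫ t in (0 : ℝ)..1, psi i t * psi l t = if i = l then 1 else 0 := by
  split_ifs with hil
  · subst hil
    simpa only [sq] using integral_psi_sq i
  · by_cases h1 : l ≠ 0 ∧ i < 2 ^ Nat.log 2 l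
    · simp only [psi_mul_psi h1.1 h1.2, intervalIntegral.integral_const_mul, integral_psi h1.1,
        mul_zero]
    by_cases h2 : i ≠ 0 ∧ l < 2 ^ Nat.log 2 i
    · simp only [mul_comm (psi i _), psi_mul_psi h2.1 h2.2, intervalIntegral.integral_const_mul,
        integral_psi h2.1, mul_zero]
    · simp only [psi_mul_psi_eq_zero hil h1 h2, intervalIntegral.integral_zero]

/-- The square of `psi i` is a multiple of the indicator of its support. A coarser `psi n` is
constant there, a finer one has mean zero, and for `n = i ≠ 0` the cube is a multiple of `psi i`,
again of mean zero. The values are the entries of `Γ`. -/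
lemma integral_psi_sq_mul_psi (i n : ℕ) :
    ∫ t in (0 : ℝ)..1, psi i t ^ 2 * psi n t =
      if i ≠ 0 ∧ n < 2 ^ Nat.log 2 i then psi n (midpt i) else if i = 0 ∧ n = 0 then 1 else 0 := by
  by_cases h1 : i ≠ 0 ∧ n < 2 ^ Nat.log 2 i
  · have : ∀ t, psi i t ^ 2 * psi n t = psi n (midpt i) * psi i t ^ 2 := fun t => by
      linear_combination psi i t * psi_mul_psi h1.1 h1.2 t
    rw [if_pos h1]
    simp only [this, intervalIntegral.integral_const_mul, integral_psi_sq, mul_one]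
  rw [if_neg h1]
  by_cases h2 : n ≠ 0 ∧ i < 2 ^ Nat.log 2 n
  · have : ∀ t, psi i t ^ 2 * psi n t = psi i (midpt n) ^ 2 * psi n t := fun t => by
      linear_combination (psi i t + psi i (midpt n)) * psi_mul_psi h2.1 h2.2 t
    simp only [this, intervalIntegral.integral_const_mul, integral_psi h2.1, mul_zero]
    rw [if_neg fun h => h2.1 h.2]
  by_cases hin : i = n
  · subst hin
    rcases eq_or_ne i 0 with rfl | hi
    · have : ∀ t, psi 0 t ^ 2 * psi 0 t = psi 0 t ^ 2 := by
        intro t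
        rw [psi_zero, scaling]
        split_ifs <;> simp
      simp only [this, integral_psi_sq, and_self, if_true]
    · rw [if_neg fun h => hi h.1]
      obtain ⟨j, k, hk, rfl⟩ := exists_eq_two_pow_add hi
      have : ∀ t, psi (2 ^ j + k) t ^ 2 * psi (2 ^ j + k) t = 2 ^ j * psi (2 ^ j + k) t := by
        intro t
        rw [psi_two_pow_add hk, wavelet_sq]
        by_cases h : t ∈ Ico ((k : ℝ) / 2 ^ j) (((k : ℝ) + 1) / 2 ^ j)
        · simp [h]
        · rw [wavelet_eq_zero h]; simp
      simp only [this, intervalIntegral.integral_const_mul, integral_psi hi, mul_zero]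
  · rw [if_neg (by rintro ⟨rfl, rfl⟩; exact hin rfl)]
    simp only [sq, mul_assoc, psi_mul_psi_eq_zero hin h2 h1, mul_zero,
      intervalIntegral.integral_zero]

/-! ### Bessel's inequality and the functions `w i` -/

lemma memLp_psi (i : ℕ) : MemLp (psi i) 2 unitMeasure := by
  obtain ⟨M, -, hM⟩ := exists_abs_psi_le i
  exact MemLp.of_bound (measurable_psi i).aestronglyMeasurable M (ae_of_all _ hM)

lemma inner_toLp {f g : ℝ → ℝ} (hf : MemLp f 2 unitMeasure) (hg : MemLp g 2 unitMeasure) :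
    inner ℝ (hf.toLp f) (hg.toLp g) = ∫ t in (0 : ℝ)..1, f t * g t := by
  rw [L2.inner_def, integral_eq_unitMeasure]
  refine integral_congr_ae ?_
  filter_upwards [hf.coeFn_toLp, hg.coeFn_toLp] with t h1 h2
  simp [h1, h2, mul_comm]

lemma orthonormal_psi : Orthonormal ℝ fun i => (memLp_psi i).toLp (psi i) := by
  rw [orthonormal_iff_ite]
  intro i l
  rw [inner_toLp, integral_psi_mul_psi]

lemma sum_haarTransform_sq_le {h : ℝ → ℝ} (hh : MemLp h 2 unitMeasure) (s : Finset ℕ) :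
    ∑ i ∈ s, haarTransform h i ^ 2 ≤ ∫ t in (0 : ℝ)..1, h t ^ 2 := by
  have := orthonormal_psi.sum_inner_products_le (hh.toLp h) (s := s)
  rw [← real_inner_self_eq_norm_sq, inner_toLp] at this
  simp only [inner_toLp, Real.norm_eq_abs, sq_abs] at this
  simpa only [haarTransform, sq (h _), mul_comm (h _)] using this

lemma memℓp_haarTransform {h : ℝ → ℝ} (hh : MemLp h 2 unitMeasure) :
    Memℓp (haarTransform h) 2 := by
  rw [memℓp_gen_iff (by norm_num)]
  refine summable_of_sum_le (c := ∫ t in (0 : ℝ)..1, h t ^ 2) (fun i => by positivity) fun s => ?_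
  simpa using sum_haarTransform_sq_le hh s

/-- `w i t` is the Haar coefficient of the indicator of `[0, t)`. -/
lemma w_eq {t : ℝ} (ht : t ∈ Icc (0 : ℝ) 1) (i : ℕ) :
    w i t = haarTransform ((Ico 0 t).indicator 1) i := by
  -- The integral is the length of the overlap of `[a, b)` and `[0, t)`.
  have key : ∀ a b : ℝ, 0 ≤ a → a ≤ b → b ≤ 1 →
      ∫ x in a..b, (Ico (0 : ℝ) t).indicator (1 : ℝ → ℝ) x = max (min b t - a) 0 := by
    intro a b ha hab hb
    rw [intervalIntegral.integral_of_le hab, ← integral_Ico_eq_integral_Ioc,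
      setIntegral_indicator measurableSet_Ico, Ico_inter_Ico, sup_eq_left.2 ha]
    simp [Measure.real, ENNReal.toReal_ofReal']
  rcases eq_or_ne i 0 with rfl | hi
  · rw [haarTransform_zero, key 0 1 le_rfl zero_le_one le_rfl]
    simp [w, ht.1, ht.2]
  · obtain ⟨j, k, hk, rfl⟩ := exists_eq_two_pow_add hi
    have h1 := dyadic_lt_mid j k
    have h2 := mid_lt_dyadic j k
    have h3 := dyadic_le_one hk
    have h0 : 0 ≤ (k : ℝ) / 2 ^ j := by positivity
    have hint : Integrable ((Ico 0 t).indicator (1 : ℝ → ℝ)) unitMeasure :=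
      (integrable_const (1 : ℝ)).indicator measurableSet_Ico
    rw [haarTransform_two_pow_add hint hk,
      key _ _ h0 h1.le (h2.le.trans h3), key _ _ (h0.trans h1.le) h2.le h3, w_two_pow_add hk,
      waveletInt]
    -- With the midpoint written as an average of the endpoints `α` and `β`, every case becomes
    -- linear in `α`, `β`, `t`.
    have e : ((k : ℝ) + 1 / 2) / 2 ^ j = ((k : ℝ) / 2 ^ j + ((k : ℝ) + 1) / 2 ^ j) / 2 := by ring
    rw [e] at *
    generalize (k : ℝ) / 2 ^ j = α at *
    generalize ((k : ℝ) + 1) / 2 ^ j = β at *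
    split_ifs with h h'
    · rw [min_eq_right h.2, max_eq_left (by linarith [h.1]), max_eq_right]
      · ring
      · linarith [min_le_right β t, h.2]
    · rw [min_eq_left h'.1, min_eq_right h'.2, max_eq_left (by linarith), max_eq_left (by linarith)]
      ring
    · rcases lt_or_ge t α with h4 | h4
      · rw [max_eq_right (by linarith [min_le_right ((α + β) / 2) t]),
          max_eq_right (by linarith [min_le_right β t])]
        ring
      · have h5 : β < t := by
          by_contra h5
          rcases le_total t ((α + β) / 2) with h6 | h6
          · exact h ⟨h4, h6⟩
          · exact h' ⟨h6, not_lt.1 h5⟩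
        rw [min_eq_left (by linarith), min_eq_left h5.le, max_eq_left (by linarith),
          max_eq_left (by linarith)]
        ring


/-! ### Series with bounded absolute partial sums -/

section Series

variable {ι : Type*} {x : ι → ℝ} {A : ℝ}

lemma summable_of_sum_abs_le (hx : ∀ s : Finset ι, ∑ i ∈ s, |x i| ≤ A) : Summable x :=
  (summable_of_sum_le (fun _ => abs_nonneg _) hx).of_abs

lemma abs_tsum_le (hx : ∀ s : Finset ι, ∑ i ∈ s, |x i| ≤ A) : |∑' i, x i| ≤ A :=
  (norm_tsum_le_tsum_norm (summable_of_sum_abs_le hx).norm).trans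
    ((summable_of_sum_abs_le hx).norm.tsum_le_of_sum_le hx)

/-- A finite set of pairs lies in the product of its two projections, where the sum factors. -/
lemma sum_abs_mul_le {y : ι → ℝ} {B : ℝ} (hA : 0 ≤ A) (hx : ∀ s : Finset ι, ∑ i ∈ s, |x i| ≤ A)
    (hy : ∀ s : Finset ι, ∑ i ∈ s, |y i| ≤ B) (s : Finset (ι × ι)) :
    ∑ p ∈ s, |x p.1 * y p.2| ≤ A * B := by
  classical
  calc ∑ p ∈ s, |x p.1 * y p.2| ≤ ∑ p ∈ s.image Prod.fst ×ˢ s.image Prod.snd, |x p.1 * y p.2| :=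
        Finset.sum_le_sum_of_subset_of_nonneg Finset.subset_product fun _ _ _ => abs_nonneg _
    _ = (∑ i ∈ s.image Prod.fst, |x i|) * ∑ i ∈ s.image Prod.snd, |y i| := by
        simp only [abs_mul, Finset.sum_product, Finset.sum_mul_sum]
    _ ≤ A * B := mul_le_mul (hx _) (hy _) (Finset.sum_nonneg fun _ _ => abs_nonneg _) hA

lemma memLp_tsum [Countable ι] {F : ι → ℝ → ℝ}
    (hF : ∀ i, AEStronglyMeasurable (F i) unitMeasure)
    (hA : ∀ t ∈ Icc (0 : ℝ) 1, ∀ s : Finset ι, ∑ i ∈ s, |F i t| ≤ A) :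
    MemLp (fun t => ∑' i, F i t) 2 unitMeasure := by
  have hmem : ∀ᵐ t ∂unitMeasure, t ∈ Icc (0 : ℝ) 1 := ae_restrict_mem measurableSet_Icc
  refine MemLp.of_bound ?_ A ?_
  · refine aestronglyMeasurable_of_tendsto_ae (atTop : Filter (Finset ι))
      (f := fun s t => ∑ i ∈ s, F i t) (fun s => ?_) ?_
    · exact Finset.aestronglyMeasurable_fun_sum _ fun i _ => hF i
    · filter_upwards [hmem] with t ht
      exact (summable_of_sum_abs_le (hA t ht)).hasSum
  · filter_upwards [hmem] with t ht using abs_tsum_le (hA t ht)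

/-- Since `unitMeasure` has mass one, the pointwise bound `A` also bounds the partial sums of the
`L¹` norms, which justifies exchanging sum and integral. -/
lemma hasSum_integral [Countable ι] {F : ι → ℝ → ℝ}
    (hF : ∀ i, AEStronglyMeasurable (F i) unitMeasure)
    (hA : ∀ t ∈ Icc (0 : ℝ) 1, ∀ s : Finset ι, ∑ i ∈ s, |F i t| ≤ A) :
    HasSum (fun i => ∫ t in (0 : ℝ)..1, F i t) (∫ t in (0 : ℝ)..1, ∑' i, F i t) := by
  have hmem : ∀ᵐ t ∂unitMeasure, t ∈ Icc (0 : ℝ) 1 := ae_restrict_mem measurableSet_Icc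
  have hint : ∀ i, Integrable (F i) unitMeasure := by
    intro i
    refine Integrable.of_bound (hF i) A ?_
    filter_upwards [hmem] with t ht
    simpa using hA t ht {i}
  simp only [integral_eq_unitMeasure]
  refine hasSum_integral_of_summable_integral_norm hint ?_
  refine summable_of_sum_le (c := A) (fun i => integral_nonneg fun t => norm_nonneg _) fun s => ?_
  rw [← integral_finsetSum _ fun i _ => (hint i).norm]
  calc ∫ t, ∑ i ∈ s, ‖F i t‖ ∂unitMeasure ≤ ∫ _t, A ∂unitMeasure := by
        refine integral_mono_ae (integrable_finsetSum _ fun i _ => (hint i).norm)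
          (integrable_const A) ?_
        filter_upwards [hmem] with t ht using hA t ht s
    _ = A := by simp

end Series

/-! ### The primitive and its Hölder continuity -/

lemma measurable_w (i : ℕ) : Measurable (w i) := by
  unfold w
  split_ifs
  · exact measurable_id
  · unfold waveletInt
    exact Measurable.ite measurableSet_Icc (by fun_prop)
      (Measurable.ite measurableSet_Icc (by fun_prop) measurable_const)

lemma sum_sq_le_norm_sq (c : SeqL2) (s : Finset ℕ) : ∑ i ∈ s, c i ^ 2 ≤ ‖c‖ ^ 2 := by
  simpa using lp.sum_rpow_le_norm_rpow (p := 2) (by norm_num) c s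

lemma sum_abs_mul_haarTransform_le (c : SeqL2) {h : ℝ → ℝ} (hh : MemLp h 2 unitMeasure)
    (s : Finset ℕ) :
    ∑ i ∈ s, |c i * haarTransform h i| ≤ ‖c‖ * √(∫ t in (0 : ℝ)..1, h t ^ 2) := by
  have h1 := Real.sum_mul_le_sqrt_mul_sqrt s (fun i => |c i|) fun i => |haarTransform h i|
  simp only [sq_abs, ← abs_mul] at h1
  refine h1.trans (mul_le_mul ?_ (Real.sqrt_le_sqrt (sum_haarTransform_sq_le hh s))
    (Real.sqrt_nonneg _) (norm_nonneg _))
  exact Real.sqrt_le_iff.2 ⟨norm_nonneg _, sum_sq_le_norm_sq c s⟩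

lemma integral_indicator_sq {s t : ℝ} (hs : 0 ≤ s) (hst : s ≤ t) (ht : t ≤ 1) :
    ∫ x in (0 : ℝ)..1, (Ico s t).indicator (1 : ℝ → ℝ) x ^ 2 = t - s := by
  have : ∀ x, (Ico s t).indicator (1 : ℝ → ℝ) x ^ 2 = 1 * (Ico s t).indicator 1 x := by
    intro x
    by_cases h : x ∈ Ico s t <;> simp [h]
  simp only [this]
  rw [integral_mul_indicator _ hs hst ht]
  simp

lemma memLp_indicator_Ico (s t : ℝ) : MemLp ((Ico s t).indicator (1 : ℝ → ℝ)) 2 unitMeasure :=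
  (memLp_const (1 : ℝ)).indicator measurableSet_Ico

lemma w_sub_w {s t : ℝ} (hs : 0 ≤ s) (hst : s ≤ t) (ht : t ≤ 1) (i : ℕ) :
    w i t - w i s = haarTransform ((Ico s t).indicator 1) i := by
  have hint : ∀ a b : ℝ, IntervalIntegrable
      (fun x => (Ico a b).indicator (1 : ℝ → ℝ) x * psi i x) volume 0 1 := fun a b =>
    intervalIntegrable_iff_unitMeasure.2 ((memLp_indicator_Ico a b).integrable_mul (memLp_psi i))
  rw [w_eq ⟨hs.trans hst, ht⟩, w_eq ⟨hs, hst.trans ht⟩, haarTransform, haarTransform,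
    ← intervalIntegral.integral_sub (hint _ _) (hint _ _)]
  refine intervalIntegral.integral_congr fun x _ => ?_
  simp only [← sub_mul]
  congr 1
  simp only [indicator_apply, mem_Ico, Pi.one_apply]
  grind

lemma sum_abs_mul_w_le (c : SeqL2) {t : ℝ} (ht : t ∈ Icc (0 : ℝ) 1) (s : Finset ℕ) :
    ∑ i ∈ s, |c i * w i t| ≤ ‖c‖ := by
  simp only [w_eq ht]
  refine (sum_abs_mul_haarTransform_le c (memLp_indicator_Ico 0 t) s).trans ?_
  rw [integral_indicator_sq le_rfl ht.1 ht.2]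
  exact mul_le_of_le_one_right (norm_nonneg _) (Real.sqrt_le_one.2 (by linarith [ht.2]))

/-- The integral from `0` of the function with Haar coefficients `c`. -/
noncomputable def primitive (c : ℕ → ℝ) (t : ℝ) : ℝ := ∑' i, c i * w i t

lemma memLp_primitive (c : SeqL2) : MemLp (primitive c) 2 unitMeasure :=
  memLp_tsum (A := ‖c‖) (fun i => ((measurable_w i).const_mul _).aestronglyMeasurable)
    fun _ ht => sum_abs_mul_w_le c ht

/-- The increments of `w i` are the Haar coefficients of the indicator of `[s, t)`, whose `L²` norm
is `√(t - s)`. -/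
lemma abs_primitive_sub_le_of_le (c : SeqL2) {s t : ℝ} (hs : 0 ≤ s) (hst : s ≤ t) (ht : t ≤ 1) :
    |primitive c t - primitive c s| ≤ ‖c‖ * √(t - s) := by
  rw [primitive, primitive, ← (summable_of_sum_abs_le (sum_abs_mul_w_le c
    ⟨hs.trans hst, ht⟩)).tsum_sub (summable_of_sum_abs_le (sum_abs_mul_w_le c ⟨hs, hst.trans ht⟩))]
  refine abs_tsum_le fun u => ?_
  simp only [← mul_sub, w_sub_w hs hst ht]
  refine (sum_abs_mul_haarTransform_le c (memLp_indicator_Ico s t) u).trans ?_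
  rw [integral_indicator_sq hs hst ht]

lemma abs_primitive_sub_le (c : SeqL2) {s t : ℝ} (hs : s ∈ Icc (0 : ℝ) 1)
    (ht : t ∈ Icc (0 : ℝ) 1) : |primitive c t - primitive c s| ≤ ‖c‖ * √|t - s| := by
  rcases le_total s t with h | h
  · rw [abs_of_nonneg (sub_nonneg.2 h)]
    exact abs_primitive_sub_le_of_le c hs.1 h ht.2
  · rw [abs_sub_comm t s, abs_sub_comm, abs_of_nonneg (sub_nonneg.2 h)]
    exact abs_primitive_sub_le_of_le c ht.1 h hs.2

lemma intervalIntegrable_primitive (c : SeqL2) {a b : ℝ} (ha : a ∈ Icc (0 : ℝ) 1)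
    (hb : b ∈ Icc (0 : ℝ) 1) : IntervalIntegrable (primitive c) volume a b := by
  refine IntervalIntegrable.mono_set (a := 0) (b := 1)
    (intervalIntegrable_iff_unitMeasure.2 ((memLp_primitive c).integrable one_le_two)) ?_
  rw [uIcc_of_le (zero_le_one' ℝ)]
  exact uIcc_subset_Icc ha hb

lemma abs_integral_primitive_sub_le (c : SeqL2) {a b t : ℝ} (ha : 0 ≤ a) (hat : a ≤ t)
    (htb : t ≤ b) (hb : b ≤ 1) :
    |(∫ x in a..b, primitive c x) - (b - a) * primitive c t| ≤ ‖c‖ * √(b - a) * (b - a) := by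
  have hab := hat.trans htb
  have e : (∫ x in a..b, primitive c x) - (b - a) * primitive c t =
      ∫ x in a..b, (primitive c x - primitive c t) := by
    rw [intervalIntegral.integral_sub (intervalIntegrable_primitive c ⟨ha, hab.trans hb⟩
      ⟨ha.trans hab, hb⟩) intervalIntegrable_const]
    simp
  rw [e]
  have := intervalIntegral.norm_integral_le_of_norm_le_const (a := a) (b := b)
    (f := fun x => primitive c x - primitive c t) (C := ‖c‖ * √(b - a)) fun x hx => by
      rw [uIoc_of_le hab] at hx
      refine (abs_primitive_sub_le c ⟨ha.trans hat, htb.trans hb⟩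
        ⟨ha.trans hx.1.le, hx.2.trans hb⟩).trans ?_
      gcongr
      rw [abs_le]
      constructor <;> linarith [hx.1, hx.2]
  rwa [abs_of_nonneg (sub_nonneg.2 hab)] at this

/-! ### The Haar series of the primitive -/

lemma mulVec_P (c : SeqL2) (l : ℕ) :
    HasSum (fun i => P.transpose l i * c i) (haarTransform (primitive c) l) := by
  obtain ⟨M, hM0, hM⟩ := exists_abs_psi_le l
  have := hasSum_integral (A := ‖c‖ * M) (F := fun i t => c i * w i t * psi l t)
    (fun i => (((measurable_w i).const_mul _).mul (measurable_psi l)).aestronglyMeasurable)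
    fun t ht s => by
      simp only [abs_mul _ (psi l t), ← Finset.sum_mul]
      exact mul_le_mul (sum_abs_mul_w_le c ht s) (hM t) (abs_nonneg _) (norm_nonneg _)
  simp only [tsum_mul_right] at this
  refine this.congr_fun ?_
  intro i
  rw [Matrix.transpose_apply, P, ← intervalIntegral.integral_mul_const]
  refine intervalIntegral.integral_congr fun x _ => ?_
  ring

/-- Both half-interval integrals are compared with the half-length times the value at the common
midpoint, and that value cancels in their difference. The extra factor `√(2 ^ j)` is the sup norm of
the wavelet, so this bounds a whole term of the Haar series. -/
lemma sqrt_mul_abs_haarTransform_primitive_le (c : SeqL2) {j k : ℕ} (hk : k < 2 ^ j) :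
    |haarTransform (primitive c) (2 ^ j + k)| * √(2 ^ j) ≤ ‖c‖ * (√(1 / 2)) ^ j := by
  have h1 := dyadic_lt_mid j k
  have h2 := mid_lt_dyadic j k
  have h3 := dyadic_le_one hk
  have h0 : 0 ≤ (k : ℝ) / 2 ^ j := by positivity
  rw [haarTransform_two_pow_add ((memLp_primitive c).integrable one_le_two) hk, abs_mul,
    abs_of_nonneg (Real.sqrt_nonneg _)]
  have b1 := abs_integral_primitive_sub_le c h0 h1.le le_rfl (h2.le.trans h3)
  have b2 := abs_integral_primitive_sub_le c (h0.trans h1.le) le_rfl h2.le h3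
  have e1 : ((k : ℝ) + 1 / 2) / 2 ^ j - (k : ℝ) / 2 ^ j = (1 / 2) ^ j / 2 := by
    rw [div_pow, one_pow]; field_simp; ring
  have e2 : ((k : ℝ) + 1) / 2 ^ j - ((k : ℝ) + 1 / 2) / 2 ^ j = (1 / 2) ^ j / 2 := by
    rw [div_pow, one_pow]; field_simp; ring
  rw [e1] at b1
  rw [e2] at b2
  have b3 : |(∫ t in (k : ℝ) / 2 ^ j..((k : ℝ) + 1 / 2) / 2 ^ j, primitive c t) -
      ∫ t in ((k : ℝ) + 1 / 2) / 2 ^ j..((k : ℝ) + 1) / 2 ^ j, primitive c t| ≤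
      ‖c‖ * √((1 / 2) ^ j / 2) * (1 / 2) ^ j := by
    rw [abs_le] at *
    constructor <;> linarith [b1.1, b1.2, b2.1, b2.2]
  have e3 : √(1 / 2 : ℝ) ^ j = √((1 / 2) ^ j) := by
    rw [eq_comm, Real.sqrt_eq_iff_mul_self_eq (by positivity) (by positivity), ← mul_pow,
      Real.mul_self_sqrt (by positivity)]
  rw [mul_right_comm, Real.mul_self_sqrt (by positivity), e3]
  calc (2 : ℝ) ^ j * _ ≤ 2 ^ j * (‖c‖ * √((1 / 2) ^ j / 2) * (1 / 2) ^ j) := by gcongr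
    _ = ‖c‖ * √((1 / 2) ^ j / 2) := by rw [div_pow, one_pow]; field_simp
    _ ≤ ‖c‖ * √((1 / 2) ^ j) := by
        gcongr
        exact half_le_self (by positivity)

lemma floor_mem_dyadic {t : ℝ} (ht : 0 ≤ t) (j : ℕ) :
    (⌊t * 2 ^ j⌋₊ : ℝ) / 2 ^ j ≤ t ∧ t < ((⌊t * 2 ^ j⌋₊ : ℝ) + 1) / 2 ^ j := by
  rw [div_le_iff₀ (by positivity), lt_div_iff₀ (by positivity)]
  exact ⟨Nat.floor_le (by positivity), Nat.lt_floor_add_one _⟩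

lemma floor_lt_two_pow {t : ℝ} (ht : t ∈ Ico (0 : ℝ) 1) (j : ℕ) : ⌊t * 2 ^ j⌋₊ < 2 ^ j := by
  rw [Nat.floor_lt (mul_nonneg ht.1 (by positivity))]
  push_cast
  exact mul_lt_of_lt_one_left (by positivity) ht.2

/-- At each level only one Haar function is nonzero at `t`. -/
lemma sum_range_two_pow_succ {t : ℝ} (ht : t ∈ Ico (0 : ℝ) 1) {F : ℕ → ℝ}
    (hF : ∀ i, psi i t = 0 → F i = 0) (j : ℕ) :
    ∑ i ∈ Finset.range (2 ^ (j + 1)), F i =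
      ∑ i ∈ Finset.range (2 ^ j), F i + F (2 ^ j + ⌊t * 2 ^ j⌋₊) := by
  rw [pow_succ, mul_two, Finset.sum_range_add]
  congr 1
  refine Finset.sum_eq_single_of_mem (f := fun k => F (2 ^ j + k)) _
    (Finset.mem_range.2 (floor_lt_two_pow ht j)) fun k hk hne => hF _ ?_
  rw [psi_two_pow_add (Finset.mem_range.1 hk)]
  exact wavelet_eq_zero fun h => hne (floor_eq_of_mem h).symm

/-- The Haar series of a Hölder continuous function converges absolutely, uniformly. -/
lemma exists_sum_abs_mul_psi_le (c : SeqL2) : ∃ M : ℝ, 0 ≤ M ∧ ∀ (t : ℝ) (s : Finset ℕ),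
    ∑ i ∈ s, |haarTransform (primitive c) i * psi i t| ≤ M := by
  have hr : √(1 / 2 : ℝ) < 1 := by
    rw [Real.sqrt_lt' one_pos]; norm_num
  have hsum := summable_geometric_of_lt_one (Real.sqrt_nonneg _) hr
  -- The scaling term plus one term of a geometric series for each level.
  set M := |haarTransform (primitive c) 0| + ‖c‖ * ∑' j : ℕ, √(1 / 2 : ℝ) ^ j with hMdef
  have hM0 : 0 ≤ M := by
    have : 0 ≤ ∑' j : ℕ, √(1 / 2 : ℝ) ^ j := tsum_nonneg fun j => by positivity
    positivity
  refine ⟨M, hM0, fun t s => ?_⟩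
  by_cases ht : t ∈ Ico (0 : ℝ) 1
  swap
  · simpa [psi_eq_zero (i := _) (show ¬(0 ≤ t ∧ t < 1) from ht)] using hM0
  have key : ∀ J : ℕ, ∑ i ∈ Finset.range (2 ^ J), |haarTransform (primitive c) i * psi i t| ≤
      |haarTransform (primitive c) 0| + ‖c‖ * ∑ j ∈ Finset.range J, √(1 / 2 : ℝ) ^ j := by
    intro J
    induction J with
    | zero =>
      have h : scaling t = 1 := if_pos ht
      simp [psi_zero, h]
    | succ J ih =>
      rw [sum_range_two_pow_succ ht (F := fun i => |haarTransform (primitive c) i * psi i t|)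
        fun i hi => by simp [hi], Finset.sum_range_succ, mul_add, ← add_assoc]
      refine add_le_add ih ?_
      have hk := floor_lt_two_pow ht J
      rw [abs_mul, psi_two_pow_add hk]
      exact (mul_le_mul_of_nonneg_left (abs_wavelet_le _ _ _) (abs_nonneg _)).trans
        (sqrt_mul_abs_haarTransform_primitive_le c hk)
  obtain ⟨N, hN⟩ := s.exists_nat_subset_range
  have hsub : s ⊆ Finset.range (2 ^ N) :=
    hN.trans (Finset.range_subset_range.2 Nat.lt_two_pow_self.le)
  refine (Finset.sum_le_sum_of_subset_of_nonneg hsub fun _ _ _ => abs_nonneg _).trans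
    ((key N).trans ?_)
  rw [hMdef]
  gcongr
  exact hsum.sum_le_tsum _ fun j _ => by positivity

/-- The partial sums of the Haar series are averages over dyadic intervals. -/
lemma sum_haarTransform_mul_psi (c : SeqL2) {t : ℝ} (ht : t ∈ Ico (0 : ℝ) 1) (J : ℕ) :
    ∑ i ∈ Finset.range (2 ^ J), haarTransform (primitive c) i * psi i t =
      2 ^ J * ∫ x in (⌊t * 2 ^ J⌋₊ : ℝ) / 2 ^ J..((⌊t * 2 ^ J⌋₊ : ℝ) + 1) / 2 ^ J,
        primitive c x := by
  induction J with
  | zero =>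
    have h : scaling t = 1 := if_pos ht
    have h' : ⌊t⌋₊ = 0 := Nat.floor_eq_zero.2 ht.2
    simp [psi_zero, h, h', haarTransform_zero]
  | succ J ih =>
    rw [sum_range_two_pow_succ ht (F := fun i => haarTransform (primitive c) i * psi i t)
      fun i hi => by simp [hi], ih]
    have hk := floor_lt_two_pow ht J
    obtain ⟨h1, h2⟩ := floor_mem_dyadic ht.1 J
    rw [psi_two_pow_add hk, haarTransform_two_pow_add ((memLp_primitive c).integrable one_le_two) hk]
    generalize ⌊t * 2 ^ J⌋₊ = k at *
    have g1 := dyadic_lt_mid J k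
    have g2 := mid_lt_dyadic J k
    have g3 := dyadic_le_one hk
    have g0 : 0 ≤ (k : ℝ) / 2 ^ J := by positivity
    have hadd := intervalIntegral.integral_add_adjacent_intervals
      (intervalIntegrable_primitive c ⟨g0, g1.le.trans (g2.le.trans g3)⟩
        ⟨g0.trans g1.le, g2.le.trans g3⟩)
      (intervalIntegrable_primitive c ⟨g0.trans g1.le, g2.le.trans g3⟩
        ⟨g0.trans (g1.le.trans g2.le), g3⟩)
    have hsq : √(2 ^ J : ℝ) * √(2 ^ J) = 2 ^ J := Real.mul_self_sqrt (by positivity)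
    rw [← hadd]
    have e1 : (k : ℝ) / 2 ^ J = ((2 * k : ℕ) : ℝ) / 2 ^ (J + 1) := by
      push_cast; field_simp; ring
    have e2 : ((k : ℝ) + 1 / 2) / 2 ^ J = (((2 * k : ℕ) : ℝ) + 1) / 2 ^ (J + 1) := by
      push_cast; field_simp; ring
    have e2' : ((k : ℝ) + 1 / 2) / 2 ^ J = ((2 * k + 1 : ℕ) : ℝ) / 2 ^ (J + 1) := by
      push_cast; field_simp; ring
    have e3 : ((k : ℝ) + 1) / 2 ^ J = (((2 * k + 1 : ℕ) : ℝ) + 1) / 2 ^ (J + 1) := by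
      push_cast; field_simp; ring
    -- With `L` and `R` the integrals over the two halves, the new term is `± 2 ^ J * (L - R)`;
    -- added to `2 ^ J * (L + R)` it leaves `2 ^ (J + 1)` times the integral over the half
    -- containing `t`.
    rcases lt_or_ge t (((k : ℝ) + 1 / 2) / 2 ^ J) with h | h
    · have hf : ⌊t * 2 ^ (J + 1)⌋₊ = 2 * k := floor_eq_of_mem ⟨e1 ▸ h1, e2 ▸ h⟩
      rw [hf, ← e1, ← e2, wavelet, if_pos ⟨h1, h⟩, pow_succ]
      linear_combination
        ((∫ t in (k : ℝ) / 2 ^ J..((k : ℝ) + 1 / 2) / 2 ^ J, primitive c t) -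
          ∫ t in ((k : ℝ) + 1 / 2) / 2 ^ J..((k : ℝ) + 1) / 2 ^ J, primitive c t) * hsq
    · have hf : ⌊t * 2 ^ (J + 1)⌋₊ = 2 * k + 1 := floor_eq_of_mem ⟨e2' ▸ h, e3 ▸ h2⟩
      rw [hf, ← e2', ← e3, wavelet, if_neg fun h' => h'.2.not_ge h, if_pos ⟨h, h2⟩, pow_succ]
      linear_combination
        -((∫ t in (k : ℝ) / 2 ^ J..((k : ℝ) + 1 / 2) / 2 ^ J, primitive c t) -
          ∫ t in ((k : ℝ) + 1 / 2) / 2 ^ J..((k : ℝ) + 1) / 2 ^ J, primitive c t) * hsq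

/-- Absolute convergence lets the sum be computed along the partial sums of length `2 ^ J`, which
are averages over intervals shrinking to `t`. The point `t = 1` is excluded because every `psi i`
vanishes there. -/
lemma tsum_haarTransform_mul_psi (c : SeqL2) {t : ℝ} (ht : t ∈ Ico (0 : ℝ) 1) :
    ∑' i, haarTransform (primitive c) i * psi i t = primitive c t := by
  obtain ⟨M, -, hM⟩ := exists_sum_abs_mul_psi_le c
  have l1 : Tendsto (fun J : ℕ => ∑ i ∈ Finset.range (2 ^ J),
      haarTransform (primitive c) i * psi i t) atTop
      (𝓝 (∑' i, haarTransform (primitive c) i * psi i t)) :=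
    (summable_of_sum_abs_le (hM t)).hasSum.tendsto_sum_nat.comp
      (tendsto_pow_atTop_atTop_of_one_lt one_lt_two)
  refine tendsto_nhds_unique l1 (tendsto_iff_norm_sub_tendsto_zero.2 ?_)
  have l2 : Tendsto (fun J : ℕ => ‖c‖ * √((1 / 2) ^ J)) atTop (𝓝 0) := by
    have := (tendsto_pow_atTop_nhds_zero_of_lt_one (r := (1 / 2 : ℝ)) (by norm_num)
      (by norm_num)).sqrt.const_mul ‖c‖
    simpa using this
  refine squeeze_zero (fun _ => norm_nonneg _) (fun J => ?_) l2
  rw [sum_haarTransform_mul_psi c ht]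
  obtain ⟨h1, h2⟩ := floor_mem_dyadic ht.1 J
  have hk := floor_lt_two_pow ht J
  generalize ⌊t * 2 ^ J⌋₊ = k at *
  have b := abs_integral_primitive_sub_le c (by positivity) h1 h2.le (dyadic_le_one hk)
  have e : ((k : ℝ) + 1) / 2 ^ J - (k : ℝ) / 2 ^ J = (1 / 2) ^ J := by
    rw [div_pow, one_pow]; field_simp; ring
  rw [e] at b
  have hp : (2 : ℝ) ^ J * (1 / 2) ^ J = 1 := by rw [← mul_pow]; norm_num
  set I := ∫ x in (k : ℝ) / 2 ^ J..((k : ℝ) + 1) / 2 ^ J, primitive c x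
  calc ‖2 ^ J * I - primitive c t‖ = 2 ^ J * |I - (1 / 2) ^ J * primitive c t| := by
        rw [Real.norm_eq_abs, ← abs_of_pos (show (0 : ℝ) < 2 ^ J by positivity), ← abs_mul,
          abs_of_pos (show (0 : ℝ) < 2 ^ J by positivity), mul_sub, ← mul_assoc, hp, one_mul]
    _ ≤ 2 ^ J * (‖c‖ * √((1 / 2) ^ J) * (1 / 2) ^ J) := by gcongr
    _ = ‖c‖ * √((1 / 2) ^ J) := by linear_combination ‖c‖ * √((1 / 2) ^ J) * hp


/-! ### Entries of the recursively given matrices -/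

section Blocks

variable {j : ℕ} (A B C D : Matrix (Fin (2 ^ j)) (Fin (2 ^ j)) ℝ) {i l : ℕ}

lemma finSumFinEquiv_symm_inl (h : 2 ^ j + 2 ^ j = 2 ^ (j + 1)) (hi : i < 2 ^ j)
    (hi' : i < 2 ^ (j + 1)) :
    ((finSumFinEquiv (m := 2 ^ j) (n := 2 ^ j)).trans (finCongr h)).symm ⟨i, hi'⟩
      = Sum.inl ⟨i, hi⟩ := by
  rw [Equiv.symm_apply_eq]; ext; simp

lemma finSumFinEquiv_symm_inr (h : 2 ^ j + 2 ^ j = 2 ^ (j + 1)) (hi : i < 2 ^ j)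
    (hi' : 2 ^ j + i < 2 ^ (j + 1)) :
    ((finSumFinEquiv (m := 2 ^ j) (n := 2 ^ j)).trans (finCongr h)).symm ⟨2 ^ j + i, hi'⟩
      = Sum.inr ⟨i, hi⟩ := by
  rw [Equiv.symm_apply_eq]; ext; simp [add_comm]

lemma blocks_apply₁₂ (hi : i < 2 ^ j) (hl : l < 2 ^ j) (hi' : i < 2 ^ (j + 1))
    (hl' : 2 ^ j + l < 2 ^ (j + 1)) :
    blocks A B C D ⟨i, hi'⟩ ⟨2 ^ j + l, hl'⟩ = B ⟨i, hi⟩ ⟨l, hl⟩ := by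
  simp only [blocks, Matrix.reindex_apply, Matrix.submatrix_apply]
  rw [finSumFinEquiv_symm_inl _ hi, finSumFinEquiv_symm_inr _ hl, Matrix.fromBlocks_apply₁₂]

lemma blocks_apply₂₁ (hi : i < 2 ^ j) (hl : l < 2 ^ j) (hi' : 2 ^ j + i < 2 ^ (j + 1))
    (hl' : l < 2 ^ (j + 1)) :
    blocks A B C D ⟨2 ^ j + i, hi'⟩ ⟨l, hl'⟩ = C ⟨i, hi⟩ ⟨l, hl⟩ := by
  simp only [blocks, Matrix.reindex_apply, Matrix.submatrix_apply]
  rw [finSumFinEquiv_symm_inr _ hi, finSumFinEquiv_symm_inl _ hl, Matrix.fromBlocks_apply₂₁]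

lemma blocks_apply₂₂ (hi : i < 2 ^ j) (hl : l < 2 ^ j) (hi' : 2 ^ j + i < 2 ^ (j + 1))
    (hl' : 2 ^ j + l < 2 ^ (j + 1)) :
    blocks A B C D ⟨2 ^ j + i, hi'⟩ ⟨2 ^ j + l, hl'⟩ = D ⟨i, hi⟩ ⟨l, hl⟩ := by
  simp only [blocks, Matrix.reindex_apply, Matrix.submatrix_apply]
  rw [finSumFinEquiv_symm_inr _ hi, finSumFinEquiv_symm_inr _ hl, Matrix.fromBlocks_apply₂₂]

end Blocks

/-- A recursively given infinite matrix is determined by the blocks of the recursion. -/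
lemma limitMatrix_eq {A B C D : ∀ j : ℕ, Matrix (Fin (2 ^ j)) (Fin (2 ^ j)) ℝ}
    (hA : ∀ j, A (j + 1) = blocks (A j) (B j) (C j) (D j)) {f : ℕ → ℕ → ℝ}
    (h0 : A 0 0 0 = f 0 0) (hB : ∀ j (i l : Fin (2 ^ j)), B j i l = f i (2 ^ j + l))
    (hC : ∀ j (i l : Fin (2 ^ j)), C j i l = f (2 ^ j + i) l)
    (hD : ∀ j (i l : Fin (2 ^ j)), D j i l = f (2 ^ j + i) (2 ^ j + l)) (i l : ℕ) :
    limitMatrix A i l = f i l := by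
  have key : ∀ j i l (hi : i < 2 ^ j) (hl : l < 2 ^ j), A j ⟨i, hi⟩ ⟨l, hl⟩ = f i l := by
    intro j
    induction j with
    | zero =>
      intro i l hi hl
      obtain rfl : i = 0 := by simpa using hi
      obtain rfl : l = 0 := by simpa using hl
      exact h0
    | succ j ih =>
      intro i l hi hl
      have hj := pow_succ 2 j
      rw [hA]
      rcases lt_or_ge i (2 ^ j) with hi' | hi' <;> rcases lt_or_ge l (2 ^ j) with hl' | hl'
      · rw [blocks_apply_of_lt _ _ _ _ hi' hl', ih]
      · obtain ⟨l, rfl⟩ := Nat.exists_eq_add_of_le hl'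
        rw [blocks_apply₁₂ _ _ _ _ hi' (by omega), hB]
      · obtain ⟨i, rfl⟩ := Nat.exists_eq_add_of_le hi'
        rw [blocks_apply₂₁ _ _ _ _ (by omega) hl', hC]
      · obtain ⟨i, rfl⟩ := Nat.exists_eq_add_of_le hi'
        obtain ⟨l, rfl⟩ := Nat.exists_eq_add_of_le hl'
        rw [blocks_apply₂₂ _ _ _ _ (by omega) (by omega), hD]
  exact key _ _ _ _ _

lemma two_pow_log_le_two_pow {j : ℕ} (i : Fin (2 ^ j)) (hi : (i : ℕ) ≠ 0) :
    2 ^ Nat.log 2 (i : ℕ) ≤ 2 ^ j :=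
  (Nat.pow_log_le_self 2 hi).trans i.2.le

/-- The sampling point of column `l` of `haarMatrix j` is the midpoint of the support of `psi (2 ^ j
+ l)`, the function indexing that column in the larger matrix. -/
lemma omegaTilde_apply (i l : ℕ) :
    omegaTilde i l = if l ≠ 0 ∧ i < 2 ^ Nat.log 2 l then psi i (midpt l) else 0 := by
  refine limitMatrix_eq (A := omegaTildeBlock) (fun _ => rfl)
    (f := fun i l => if l ≠ 0 ∧ i < 2 ^ Nat.log 2 l then psi i (midpt l) else 0) ?_ ?_ ?_ ?_ i l
  · simp [omegaTildeBlock]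
  · intro j i l
    simp [log_two_pow_add l.2, midpt_two_pow_add l.2, haarMatrix]
  · intro j i l
    rw [if_neg]
    · rfl
    · rintro ⟨h1, h2⟩
      have := two_pow_log_le_two_pow l h1
      omega
  · intro j i l
    simp [log_two_pow_add l.2]

lemma omega_apply (t : ℝ) (i l : ℕ) : omega t i l = omegaTilde i l * psi l t := by
  simp only [omegaTilde_apply]
  refine limitMatrix_eq (A := omegaBlock t) (fun _ => rfl) (f := fun i l =>
    (if l ≠ 0 ∧ i < 2 ^ Nat.log 2 l then psi i (midpt l) else 0) * psi l t) ?_ ?_ ?_ ?_ i l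
  · simp [omegaBlock]
  · intro j i l
    simp [log_two_pow_add l.2, midpt_two_pow_add l.2, haarMatrix, upsilon]
  · intro j i l
    rw [if_neg, zero_mul]
    · rfl
    · rintro ⟨h1, h2⟩
      have := two_pow_log_le_two_pow l h1
      omega
  · intro j i l
    simp [log_two_pow_add l.2]

lemma gamma_apply (i l : ℕ) : gamma i l =
    if i ≠ 0 ∧ l < 2 ^ Nat.log 2 i then psi l (midpt i) else if i = 0 ∧ l = 0 then 1 else 0 := by
  refine limitMatrix_eq (A := gammaBlock) (fun _ => rfl) (f := fun i l =>
    if i ≠ 0 ∧ l < 2 ^ Nat.log 2 i then psi l (midpt i) else if i = 0 ∧ l = 0 then 1 else 0)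
    ?_ ?_ ?_ ?_ i l
  · simp [gammaBlock]
  · intro j i l
    rw [if_neg, if_neg]
    · rfl
    · rintro ⟨-, h⟩
      have := Nat.two_pow_pos j
      omega
    · rintro ⟨h1, h2⟩
      have := two_pow_log_le_two_pow i h1
      omega
  · intro j i l
    simp [log_two_pow_add i.2, midpt_two_pow_add i.2, haarMatrix]
  · intro j i l
    simp [log_two_pow_add i.2]

lemma omega_eq_mul (t : ℝ) (i l : ℕ) :
    omega t i l = if l ≠ 0 ∧ i < 2 ^ Nat.log 2 l then psi i t * psi l t else 0 := by
  rw [omega_apply, omegaTilde_apply]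
  split_ifs with h
  · rw [psi_mul_psi h.1 h.2]
  · rw [zero_mul]

/-- Exactly one of three cases occurs: `i` is coarser, `l` is coarser, or neither. In the last case
only the diagonal survives, by disjointness of supports. -/
lemma psi_mul_psi_eq_add (t : ℝ) (i l : ℕ) :
    psi i t * psi l t = omega t i l + (omega t).transpose i l + theta t i l := by
  rw [Matrix.transpose_apply, omega_eq_mul, omega_eq_mul, theta, Matrix.diagonal_apply]
  have hlog : ∀ {n : ℕ}, n ≠ 0 → 2 ^ Nat.log 2 n ≤ n := Nat.pow_log_le_self 2
  by_cases h1 : l ≠ 0 ∧ i < 2 ^ Nat.log 2 l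
  · have := hlog h1.1
    rw [if_pos h1, if_neg, if_neg (by omega)]
    · ring
    · rintro ⟨h2, h3⟩
      have := hlog h2
      omega
  by_cases h2 : i ≠ 0 ∧ l < 2 ^ Nat.log 2 i
  · have := hlog h2.1
    rw [if_neg h1, if_pos h2, if_neg (by omega)]
    ring
  rw [if_neg h1, if_neg h2]
  split_ifs with h
  · rw [h]; ring
  · rw [psi_mul_psi_eq_zero h h1 h2]; ring

lemma abs_omega_le (t : ℝ) (i l : ℕ) : |omega t i l| ≤ |psi i t * psi l t| := by
  rw [omega_eq_mul]
  split_ifs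
  · exact le_rfl
  · rw [abs_zero]; exact abs_nonneg _

lemma abs_theta_le (t : ℝ) (i l : ℕ) : |theta t i l| ≤ |psi i t * psi l t| := by
  rw [theta, Matrix.diagonal_apply]
  split_ifs with h
  · rw [h, sq]
  · rw [abs_zero]; exact abs_nonneg _

lemma measurable_omega (i l : ℕ) : Measurable fun t => omega t i l := by
  simp only [omega_apply]
  exact (measurable_psi l).const_mul _

lemma measurable_theta (i l : ℕ) : Measurable fun t => theta t i l := by
  simp only [theta, Matrix.diagonal_apply]
  split_ifs
  · exact (measurable_psi i).pow_const 2
  · exact measurable_const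

/-! ### Bilinear forms and their Haar transforms -/

lemma form_transpose (x : ℕ → ℝ) (A : Matrix ℕ ℕ ℝ) (y : ℕ → ℝ) :
    form x A.transpose y = form y A x := by
  rw [form, form, ← (Equiv.prodComm ℕ ℕ).tsum_eq]
  refine tsum_congr fun p => ?_
  simp only [Equiv.prodComm_apply, Prod.fst_swap, Prod.snd_swap, Matrix.transpose_apply]
  ring

lemma FormSummable.transpose {x : ℕ → ℝ} {A : Matrix ℕ ℕ ℝ} {y : ℕ → ℝ}
    (h : FormSummable y A x) : FormSummable x A.transpose y := by
  refine ((Equiv.prodComm ℕ ℕ).summable_iff.2 h).congr fun p => ?_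
  simp only [Function.comp_apply, Equiv.prodComm_apply, Prod.fst_swap, Prod.snd_swap,
    Matrix.transpose_apply]
  ring

section Form

variable {a b : ℕ → ℝ} {A B : ℝ} {K : ℝ → Matrix ℕ ℕ ℝ}

/-- Entrywise domination by `psi i t * psi l t` reduces the double sum to a product of two Haar
series, uniformly in `t`. -/
lemma sum_abs_form_le (hA : 0 ≤ A) (ha : ∀ t (s : Finset ℕ), ∑ i ∈ s, |a i * psi i t| ≤ A)
    (hb : ∀ t (s : Finset ℕ), ∑ i ∈ s, |b i * psi i t| ≤ B)
    (hK : ∀ t i l, |K t i l| ≤ |psi i t * psi l t|) (t : ℝ) (s : Finset (ℕ × ℕ)) :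
    ∑ p ∈ s, |a p.1 * K t p.1 p.2 * b p.2| ≤ A * B := by
  refine (Finset.sum_le_sum fun p _ => ?_).trans (sum_abs_mul_le hA (ha t) (hb t) s)
  calc |a p.1 * K t p.1 p.2 * b p.2| = |K t p.1 p.2| * (|a p.1| * |b p.2|) := by
        rw [abs_mul, abs_mul]; ring
    _ ≤ |psi p.1 t * psi p.2 t| * (|a p.1| * |b p.2|) := 
        mul_le_mul_of_nonneg_right (hK _ _ _) (by positivity)
    _ = |a p.1 * psi p.1 t * (b p.2 * psi p.2 t)| := by simp only [abs_mul]; ring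

lemma memLp_form (hA : 0 ≤ A) (ha : ∀ t (s : Finset ℕ), ∑ i ∈ s, |a i * psi i t| ≤ A)
    (hb : ∀ t (s : Finset ℕ), ∑ i ∈ s, |b i * psi i t| ≤ B)
    (hK : ∀ t i l, |K t i l| ≤ |psi i t * psi l t|)
    (hm : ∀ i l, Measurable fun t => K t i l) :
    MemLp (fun t => form a (K t) b) 2 unitMeasure :=
  memLp_tsum (fun p => (((hm p.1 p.2).const_mul _).mul_const _).aestronglyMeasurable)
    fun t _ => sum_abs_form_le hA ha hb hK t

lemma hasSum_haarTransform_form (hA : 0 ≤ A)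
    (ha : ∀ t (s : Finset ℕ), ∑ i ∈ s, |a i * psi i t| ≤ A)
    (hb : ∀ t (s : Finset ℕ), ∑ i ∈ s, |b i * psi i t| ≤ B)
    (hK : ∀ t i l, |K t i l| ≤ |psi i t * psi l t|)
    (hm : ∀ i l, Measurable fun t => K t i l) (n : ℕ) :
    HasSum (fun p : ℕ × ℕ => a p.1 * (∫ t in (0 : ℝ)..1, K t p.1 p.2 * psi n t) * b p.2)
      (haarTransform (fun t => form a (K t) b) n) := by
  obtain ⟨M, hM0, hM⟩ := exists_abs_psi_le n
  -- The bound on the empty sum gives nonnegativity of `B`.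
  have hB : 0 ≤ B := by simpa using hb 0 ∅
  have := hasSum_integral (A := A * B * M)
    (F := fun (p : ℕ × ℕ) t => a p.1 * K t p.1 p.2 * b p.2 * psi n t)
    (fun p => ((((hm p.1 p.2).const_mul _).mul_const _).mul (measurable_psi n)).aestronglyMeasurable)
    fun t ht s => by
      simp only [abs_mul _ (psi n t), ← Finset.sum_mul]
      exact mul_le_mul (sum_abs_form_le hA ha hb hK t s) (hM t) (abs_nonneg _) (mul_nonneg hA hB)
  simp only [tsum_mul_right] at this
  refine this.congr_fun fun p => ?_
  rw [← intervalIntegral.integral_const_mul, ← intervalIntegral.integral_mul_const]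
  refine intervalIntegral.integral_congr fun x _ => ?_
  ring

lemma mulVecSummable_omegaTilde_transpose (a : ℕ → ℝ) :
    MulVecSummable omegaTilde.transpose a := by
  intro n
  refine summable_of_ne_finset_zero (s := Finset.range (2 ^ Nat.log 2 n)) fun i hi => ?_
  rw [Matrix.transpose_apply, omegaTilde_apply, if_neg, zero_mul]
  rintro ⟨-, h⟩
  exact hi (Finset.mem_range.2 h)

/-- In `Ω(t)` only the factor `psi l t` depends on `t`, so by orthonormality the `n`-th coefficient
keeps just column `n` of the double series. -/
lemma haarTransform_form_omega (hA : 0 ≤ A)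
    (ha : ∀ t (s : Finset ℕ), ∑ i ∈ s, |a i * psi i t| ≤ A)
    (hb : ∀ t (s : Finset ℕ), ∑ i ∈ s, |b i * psi i t| ≤ B) :
    haarTransform (fun t => form a (omega t) b) = mulVec omegaTilde.transpose a * b := by
  ext n
  have h := hasSum_haarTransform_form hA ha hb abs_omega_le measurable_omega n
  have hinj : Function.Injective fun i : ℕ => (i, n) := fun i l h => congrArg Prod.fst h
  simp only [omega_apply, mul_assoc (omegaTilde _ _), intervalIntegral.integral_const_mul,
    integral_psi_mul_psi] at h
  rw [← hinj.hasSum_iff] at h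
  · refine h.unique ?_
    refine (((mulVecSummable_omegaTilde_transpose a) n).hasSum.mul_right (b n)).congr_fun fun i => ?_
    simp only [Function.comp_apply, if_true, Matrix.transpose_apply]
    ring
  · rintro ⟨i, l⟩ hp
    have hl : l ≠ n := by
      rintro rfl
      exact hp ⟨i, rfl⟩
    simp [hl]

lemma hasSum_haarTransform_form_theta (hA : 0 ≤ A)
    (ha : ∀ t (s : Finset ℕ), ∑ i ∈ s, |a i * psi i t| ≤ A)
    (hb : ∀ t (s : Finset ℕ), ∑ i ∈ s, |b i * psi i t| ≤ B) (n : ℕ) :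
    HasSum (fun i => gamma.transpose n i * (a * b) i)
      (haarTransform (fun t => form a (theta t) b) n) := by
  have h := hasSum_haarTransform_form hA ha hb abs_theta_le measurable_theta n
  have hinj : Function.Injective fun i : ℕ => (i, i) := fun i l h => congrArg Prod.fst h
  rw [← hinj.hasSum_iff] at h
  · refine h.congr_fun fun i => ?_
    simp only [Function.comp_apply, theta, Matrix.diagonal_apply, if_true,
      integral_psi_sq_mul_psi, Matrix.transpose_apply, gamma_apply, Pi.mul_apply]
    ring
  · rintro ⟨i, l⟩ hp
    have hl : i ≠ l := by
      rintro rfl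
      exact hp ⟨i, rfl⟩
    simp [theta, hl]

end Form

/-! ### The form `W` and the assembly of the theorem -/

lemma W_term (c d : ℕ → ℝ) (t : ℝ) (p : ℕ × ℕ) :
    c p.1 * wwT t p.1 p.2 * d p.2 = c p.1 * w p.1 t * (d p.2 * w p.2 t) := by
  rw [wwT, Matrix.vecMulVec_apply]; ring

lemma sum_abs_W_le (c d : SeqL2) {t : ℝ} (ht : t ∈ Icc (0 : ℝ) 1) (s : Finset (ℕ × ℕ)) :
    ∑ p ∈ s, |c p.1 * wwT t p.1 p.2 * d p.2| ≤ ‖c‖ * ‖d‖ := by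
  simp only [W_term]
  exact sum_abs_mul_le (norm_nonneg c) (sum_abs_mul_w_le c ht) (sum_abs_mul_w_le d ht) s

lemma memLp_W (c d : SeqL2) : MemLp (W c d) 2 unitMeasure := by
  refine memLp_tsum (A := ‖c‖ * ‖d‖) (fun p => ?_) fun t ht => sum_abs_W_le c d ht
  simp only [W_term]
  exact (((measurable_w _).const_mul _).mul ((measurable_w _).const_mul _)).aestronglyMeasurable

lemma eLpNorm_W_le (c d : SeqL2) :
    eLpNorm (W c d) 2 unitMeasure ≤ ENNReal.ofReal (‖c‖ * ‖d‖) := by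
  refine (eLpNorm_le_of_ae_bound (C := ‖c‖ * ‖d‖) ?_).trans (by simp)
  filter_upwards [ae_restrict_mem measurableSet_Icc] with t ht
  exact abs_tsum_le (sum_abs_W_le c d ht)

lemma W_eq_primitive_mul (c d : SeqL2) {t : ℝ} (ht : t ∈ Icc (0 : ℝ) 1) :
    W c d t = primitive c t * primitive d t := by
  rw [primitive, primitive, tsum_mul_tsum_of_summable_norm
    (summable_of_sum_abs_le (sum_abs_mul_w_le c ht)).norm
    (summable_of_sum_abs_le (sum_abs_mul_w_le d ht)).norm]
  exact tsum_congr (W_term c d t)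

lemma haarTransform_congr_ae {f g : ℝ → ℝ} (h : f =ᵐ[unitMeasure] g) :
    haarTransform f = haarTransform g := by
  ext n
  rw [haarTransform, haarTransform, integral_eq_unitMeasure, integral_eq_unitMeasure]
  exact integral_congr_ae (h.mul (ae_eq_refl (psi n)))

lemma haarTransform_add {f g : ℝ → ℝ} (hf : MemLp f 2 unitMeasure) (hg : MemLp g 2 unitMeasure) :
    haarTransform (f + g) = haarTransform f + haarTransform g := by
  ext n
  simp only [haarTransform, Pi.add_apply, add_mul]
  exact intervalIntegral.integral_add
    (intervalIntegrable_iff_unitMeasure.2 (hf.integrable_mul (memLp_psi n)))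
    (intervalIntegrable_iff_unitMeasure.2 (hg.integrable_mul (memLp_psi n)))

end HaarBiform

theorem theorem4p1 :
    -- boundedness of the bilinear form `W` from `ℓ² × ℓ²` into `L²[0, 1]`
    (∃ C : ℝ, 0 < C ∧ ∀ c d : SeqL2,
      (∀ t ∈ Icc (0 : ℝ) 1, FormSummable c (wwT t) d) ∧
      MemLp (W c d) 2 unitMeasure ∧
      eLpNorm (W c d) 2 unitMeasure ≤ ENNReal.ofReal (C * ‖c‖ * ‖d‖)) ∧
    ∀ (c d : SeqL2) (a b : ℕ → ℝ), a = mulVec P.transpose c → b = mulVec P.transpose d →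
      -- `a` and `b` are well-defined elements of `ℓ²`
      (MulVecSummable P.transpose c ∧ MulVecSummable P.transpose d ∧ Memℓp a 2 ∧ Memℓp b 2) ∧
      -- the splitting of `W`
      (∀ t ∈ Icc (0 : ℝ) 1, FormSummable a (omega t) b ∧
        FormSummable a (omega t).transpose b ∧ FormSummable a (theta t) b) ∧
      (∀ t ∈ Ico (0 : ℝ) 1, W c d t =
        form a (omega t) b + form a (omega t).transpose b + form a (theta t) b) ∧
      -- the three terms lie in `L²[0, 1]`, and the Haar transform splits accordingly
      (MemLp (fun t => form a (omega t) b) 2 unitMeasure ∧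
        MemLp (fun t => form a (omega t).transpose b) 2 unitMeasure ∧
        MemLp (fun t => form a (theta t) b) 2 unitMeasure) ∧
      haarTransform (W c d) =
        haarTransform (fun t => form a (omega t) b) +
          haarTransform (fun t => form a (omega t).transpose b) +
          haarTransform (fun t => form a (theta t) b) ∧
      -- the Haar transforms of the three terms (`*` is the entrywise product of sequences)
      (MulVecSummable omegaTilde.transpose a ∧ MulVecSummable omegaTilde.transpose b ∧
        MulVecSummable gamma.transpose (a * b)) ∧
      haarTransform (fun t => form a (omega t) b) = mulVec omegaTilde.transpose a * b ∧
      haarTransform (fun t => form a (omega t).transpose b) =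
        mulVec omegaTilde.transpose b * a ∧
      haarTransform (fun t => form a (theta t) b) = mulVec gamma.transpose (a * b) ∧
      Memℓp (mulVec omegaTilde.transpose a * b) 2 ∧
      Memℓp (mulVec omegaTilde.transpose b * a) 2 ∧
      Memℓp (mulVec gamma.transpose (a * b)) 2 := by
  refine ⟨⟨1, one_pos, fun c d => ⟨fun t ht => summable_of_sum_abs_le (sum_abs_W_le c d ht),
    memLp_W c d, by simpa using eLpNorm_W_le c d⟩⟩, ?_⟩
  intro c d a b ha hb
  replace ha : a = haarTransform (primitive c) := ha.trans (funext fun l => (mulVec_P c l).tsum_eq)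
  replace hb : b = haarTransform (primitive d) := hb.trans (funext fun l => (mulVec_P d l).tsum_eq)
  obtain ⟨A, hA, hAa⟩ := exists_sum_abs_mul_psi_le c
  obtain ⟨B, hB, hBb⟩ := exists_sum_abs_mul_psi_le d
  rw [← ha] at hAa
  rw [← hb] at hBb
  have sΩ : ∀ t, FormSummable a (omega t) b := fun t =>
    summable_of_sum_abs_le (sum_abs_form_le hA hAa hBb abs_omega_le t)
  have sΩT : ∀ t, FormSummable a (omega t).transpose b := fun t =>
    FormSummable.transpose (summable_of_sum_abs_le (sum_abs_form_le hB hBb hAa abs_omega_le t))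
  have sΘ : ∀ t, FormSummable a (theta t) b := fun t =>
    summable_of_sum_abs_le (sum_abs_form_le hA hAa hBb abs_theta_le t)
  have mΩ : MemLp (fun t => form a (omega t) b) 2 unitMeasure :=
    memLp_form hA hAa hBb abs_omega_le measurable_omega
  have mΩT : MemLp (fun t => form a (omega t).transpose b) 2 unitMeasure := by
    simp only [form_transpose]
    exact memLp_form hB hBb hAa abs_omega_le measurable_omega
  have mΘ : MemLp (fun t => form a (theta t) b) 2 unitMeasure :=
    memLp_form hA hAa hBb abs_theta_le measurable_theta
  have hW : ∀ t ∈ Ico (0 : ℝ) 1, W c d t =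
      form a (omega t) b + form a (omega t).transpose b + form a (theta t) b := by
    intro t ht
    rw [W_eq_primitive_mul c d ⟨ht.1, ht.2.le⟩, ← tsum_haarTransform_mul_psi c ht,
      ← tsum_haarTransform_mul_psi d ht, ← ha, ← hb, tsum_mul_tsum_of_summable_norm
      (summable_of_sum_abs_le (hAa t)).norm (summable_of_sum_abs_le (hBb t)).norm, form, form, form,
      ← (sΩ t).tsum_add (sΩT t), ← ((sΩ t).add (sΩT t)).tsum_add (sΘ t)]
    refine tsum_congr fun p => ?_
    linear_combination a p.1 * b p.2 * psi_mul_psi_eq_add t p.1 p.2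
  have hΩ := haarTransform_form_omega hA hAa hBb
  have hΩT : haarTransform (fun t => form a (omega t).transpose b) =
      mulVec omegaTilde.transpose b * a := by
    simp only [form_transpose]
    exact haarTransform_form_omega hB hBb hAa
  have hΘ := hasSum_haarTransform_form_theta hA hAa hBb
  have hΘ' : haarTransform (fun t => form a (theta t) b) = mulVec gamma.transpose (a * b) :=
    funext fun n => (hΘ n).tsum_eq.symm
  -- All the sequences claimed to be in `ℓ²` are Haar transforms of `L²` functions, so Bessel's
  -- inequality applies.
  refine ⟨⟨fun l => (mulVec_P c l).summable, fun l => (mulVec_P d l).summable,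
    ha ▸ memℓp_haarTransform (memLp_primitive c), hb ▸ memℓp_haarTransform (memLp_primitive d)⟩,
    fun t _ => ⟨sΩ t, sΩT t, sΘ t⟩, hW, ⟨mΩ, mΩT, mΘ⟩, ?_,
    ⟨mulVecSummable_omegaTilde_transpose a, mulVecSummable_omegaTilde_transpose b,
      fun n => (hΘ n).summable⟩, hΩ, hΩT, hΘ',
    hΩ ▸ memℓp_haarTransform mΩ, hΩT ▸ memℓp_haarTransform mΩT, hΘ' ▸ memℓp_haarTransform mΘ⟩
  refine Eq.trans ?_ ((haarTransform_add (mΩ.add mΩT) mΘ).trans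
    (by rw [haarTransform_add mΩ mΩT]))
  refine haarTransform_congr_ae ?_
  -- The splitting holds on `[0, 1)`; the remaining point `1` is a null set.
  have h1 : ∀ᵐ t ∂unitMeasure, t ≠ 1 := (measure_eq_zero_iff_ae_notMem (s := {1})).1 (by simp)
  filter_upwards [ae_restrict_mem measurableSet_Icc, h1] with t ht ht1
  exact hW t ⟨ht.1, ht.2.lt_of_ne ht1⟩
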